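/- Write $\Sigma=\{(x,y)\in\mathbb R^2: y=0\}$ and $\Sigma^+=\{(x,y)\in\mathbb R^2: y\ge 0\}$. Let $Z^+=(P,Q)$ be a real-analytic vector field on an open set $U\subset\mathbb R^2$, and let $\Gamma\subset U$ be a periodic orbit of $Z^+$, of minimal period $T_0>0$, such that $\Gamma\subset\Sigma^+$ and $\Gamma\cap\Sigma=\{(0,0)\}$. Suppose that the contact of $\Gamma$ with $\Sigma$ at the origin has order $2n$ for some integer $n\ge1$; that is, $t=0$ is a zero of multiplicity exactly $2n$ of the second coordinate of the solution of $Z^+$ with initial condition $(0,0)$. For $x_0>0$, call a pair of functions $\varphi^+:[0,x_0)\to\mathbb R$, $\tau^+:(0,x_0)\to\mathbb R$ a half-return map with flight time of $Z^+$ on $[0,x_0)$ if both are continuous, $\varphi^+(0)=0$, and for every $x\in(0,x_0)$ one has $\varphi^+(x)<0$, the solution $\psi$ of $Z^+$ with $\psi(0)=(x,0)$ is defined on the closed interval bounded by $0$ and $\tau^+(x)$ (where $\tau^+(x)$ may be negative), satisfies $\psi(\tau^+(x))=(\varphi^+(x),0)$, and lies in $\{y>0\}$ at all times strictly between $0$ and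 $\tau^+(x)$. Then there are $r>0$ and real sequences $(\alpha_i)_{i\ge1}$ and $(\hat T_i)_{i\ge0}$ such that a half-return map with flight time exists on $[0,r)$, and every half-return map $\varphi^+$ with flight time $\tau^+$, on any $[0,x_0)$, is given near $0$ by the convergent power series $$\varphi^+(x)=\sum_{i\ge1}\alpha_i x^i\quad (0\le x<\min\{r,x_0\}),\qquad \tau^+(x)=\hat T_0+\sum_{i\ge1}\hat T_i x^i\quad (0<x<\min\{r,x_0\}).$$ In particular $\varphi^+$ and $\tau^+$ are analytic at $0$. Moreover $|\hat T_0|=T_0$ and $P(0,0)\,\hat T_0>0$. -/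

import Mathlib

namespace HalfReturn

/-- The closed upper half-plane `Σ⁺ = {y ≥ 0}`. -/
def upperHalf : Set (ℝ × ℝ) := {p | 0 ≤ p.2}

/-- The switching line `Σ = {y = 0}`. -/
def switchingLine : Set (ℝ × ℝ) := {p | p.2 = 0}

/-- `ψ` restricted to the set `I` of times is a solution of the planar autonomous system
`ẋ = P(x, y)`, `ẏ = Q(x, y)` that stays in the domain `U` of the vector field. -/
def IsSolutionOn (P Q : ℝ × ℝ → ℝ) (U : Set (ℝ × ℝ)) (ψ : ℝ → ℝ × ℝ) (I : Set ℝ) : Prop :=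
  Set.MapsTo ψ I U ∧ IsIntegralCurveOn ψ (fun _ p => (P p, Q p)) I

/-- `Γ` is a periodic orbit, of (minimal) period `T`, of the vector field `(P, Q)` on `U`. -/
def IsPeriodicOrbit (P Q : ℝ × ℝ → ℝ) (U Γ : Set (ℝ × ℝ)) (T : ℝ) : Prop :=
  0 < T ∧ ∃ ψ : ℝ → ℝ × ℝ, IsSolutionOn P Q U ψ Set.univ ∧ Function.Periodic ψ T ∧
    Set.InjOn ψ (Set.Ico 0 T) ∧ Set.range ψ = Γ

/-- The trajectory of `(P, Q)` through `p` has a contact of order `m` with `Σ = {y = 0}` at `p`: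
`t = 0` is a zero of multiplicity `m` of the second coordinate of the solution starting at `p`. -/
def HasContact (P Q : ℝ × ℝ → ℝ) (U : Set (ℝ × ℝ)) (p : ℝ × ℝ) (m : ℕ) : Prop :=
  ∃ (ψ : ℝ → ℝ × ℝ) (ε : ℝ), 0 < ε ∧ IsSolutionOn P Q U ψ (Set.Ioo (-ε) ε) ∧ ψ 0 = p ∧
    analyticOrderAt (fun t => (ψ t).2) 0 = (m : ℕ∞)

/-- `φ : [0, x₀) → ℝ` is a half-return map on the side `Σ⁺` of the vector field `(P, Q)`, with
flight time `τ : (0, x₀) → ℝ` (the time may be negative): the solution with initial condition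
`(x, 0)` is at `(φ x, 0)`, `φ x < 0`, at time `τ x`, and has second coordinate `y > 0` at all times
strictly between `0` and `τ x`; moreover `τ` and `φ` are continuous and `φ 0 = 0`. -/
structure IsHalfReturn (P Q : ℝ × ℝ → ℝ) (U : Set (ℝ × ℝ)) (x₀ : ℝ) (τ φ : ℝ → ℝ) : Prop where
  pos : 0 < x₀
  continuousOn_time : ContinuousOn τ (Set.Ioo 0 x₀)
  continuousOn_map : ContinuousOn φ (Set.Ico 0 x₀)
  map_zero : φ 0 = 0
  map_neg : ∀ x ∈ Set.Ioo 0 x₀, φ x < 0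
  exists_solution : ∀ x ∈ Set.Ioo 0 x₀, ∃ ψ : ℝ → ℝ × ℝ,
    IsSolutionOn P Q U ψ (Set.uIcc 0 (τ x)) ∧ ψ 0 = (x, 0) ∧ ψ (τ x) = (φ x, 0) ∧
      ∀ t ∈ Set.uIoo 0 (τ x), 0 < (ψ t).2

end HalfReturn

/-! Since `y ≥ 0` along the orbit, `Q(0,0) = 0`, and `P(0,0) ≠ 0` because otherwise the origin would
be an equilibrium; reversing time one may assume `P(0,0) > 0`. The axis is tangent to the orbit at
the origin, so the return is studied through the vertical section `x = 0`: `Θ (t, h)` is the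
solution started at `(0, h)`. Near the origin `y` has the sign of `h - e t` for an analytic `e`
(`IsTransversalFlow.exists_level`). On the orbit itself, `h = 0`, this makes `-e` comparable with `y
∘ γ`, hence `e = -w ^ (2n)` with `w` a local analytic coordinate (`exists_analyticAt_root`).

After one period, `Θ (T + s, h) = Θ (s + ρ h, q h)` with `q 0 = 0` and `q' 0 > 0`, the flow
preserving orientation (`IsTransversalFlow.exists_return`). A solution leaving the axis at time `t >
0` has level `e t` and comes back at the section time `σ < 0` solving `e σ = q (e t)`. Both sides
are minus a `2n`-th power times a positive factor, so extracting the root with the opposite sign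
gives an analytic `σ` (`exists_analyticAt_involution`). Parametrizing the axis by the time `t` then
yields analytic formulas for position and flight time (`IsTransversalFlow.exists_upperArc`). Any
half-return map must follow this arc: forwards it is the first return, and backwards the solution is
immediately below the axis (`IsHalfReturn.eq_of_isUpperArc`).

The analytic flow comes from the implicit function theorem for the integral equation in a space of
continuous functions, and is continued along the orbit by concatenation. -/

open Set Filter Topology Metric
open scoped ContDiff

namespace HalfReturn

/-! ### Analyticity of composition operators on spaces of continuous functions -/

section Superposition

variable {E F : Type*} [NormedAddCommGroup E] [NormedSpace ℝ E]
  [NormedAddCommGroup F] [NormedSpace ℝ F] {K : Type*} [TopologicalSpace K] [CompactSpace K]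

/-- The pointwise action of a continuous multilinear map on continuous functions. -/
noncomputable def pointwiseMultilinear (K : Type*) [TopologicalSpace K] [CompactSpace K] {n : ℕ}
    (q : ContinuousMultilinearMap ℝ (fun _ : Fin n => E) F) :
    ContinuousMultilinearMap ℝ (fun _ : Fin n => C(K, E)) C(K, F) :=
  MultilinearMap.mkContinuous
    { toFun := fun v => ⟨fun s => q (fun i => v i s),
        q.cont.comp (continuous_pi fun i => (v i).continuous)⟩
      map_update_add' := by
        intro _ m i x y
        ext s
        have h : ∀ z : C(K, E), (fun j => Function.update m i z j s)
            = Function.update (fun j => m j s) i (z s) := fun z => by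
          ext j; by_cases hj : j = i
          · subst hj; simp
          · simp [hj]
        simp [h]
      map_update_smul' := by
        intro _ m i c x
        ext s
        have h : ∀ z : C(K, E), (fun j => Function.update m i z j s)
            = Function.update (fun j => m j s) i (z s) := fun z => by
          ext j; by_cases hj : j = i
          · subst hj; simp
          · simp [hj]
        simp [h] }
    ‖q‖ (by
      intro v
      refine (ContinuousMap.norm_le _ (by positivity)).2 fun s => ?_
      refine (q.le_opNorm _).trans ?_
      gcongr with i
      exact (v i).norm_coe_le_norm s)

theorem norm_pointwiseMultilinear_le {n : ℕ}
    (q : ContinuousMultilinearMap ℝ (fun _ : Fin n => E) F) : ‖pointwiseMultilinear K q‖ ≤ ‖q‖ :=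
  MultilinearMap.mkContinuous_norm_le _ (norm_nonneg _) _

/-- Composition with an analytic map is, near a constant function, an analytic operator on
continuous functions. -/
theorem exists_analyticAt_superposition [CompleteSpace F] {f : E → F} {p : E}
    (hf : AnalyticAt ℝ f p) :
    ∃ N : C(K, E) → C(K, F), AnalyticAt ℝ N (ContinuousMap.const K p) ∧
      ∀ᶠ u in 𝓝 (ContinuousMap.const K p), ∀ s, N u s = f (u s) := by
  obtain ⟨a, R, ha⟩ := hf
  let q : FormalMultilinearSeries ℝ C(K, E) C(K, F) := fun n => pointwiseMultilinear K (a n)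
  -- Acting pointwise does not increase the norm of a coefficient, so the series of operators
  -- converges at least where that of `f` does.
  have hrad : a.radius ≤ q.radius := by
    refine ENNReal.le_of_forall_nnreal_lt fun r hr => ?_
    obtain ⟨C, -, hC⟩ := a.norm_mul_pow_le_of_lt_radius hr
    refine q.le_radius_of_bound C fun n => ?_
    refine le_trans ?_ (hC n)
    gcongr
    exact norm_pointwiseMultilinear_le _
  have hRq : R ≤ q.radius := ha.r_le.trans hrad
  have hq := q.hasFPowerSeriesOnBall (ha.r_pos.trans_le hRq)
  refine ⟨fun u => q.sum (u - ContinuousMap.const K p), ?_, ?_⟩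
  · have h1 : AnalyticAt ℝ q.sum (ContinuousMap.const K p - ContinuousMap.const K p) := by
      rw [sub_self]; exact hq.analyticAt
    exact h1.comp_of_eq (by fun_prop) rfl
  · have : Metric.eball (ContinuousMap.const K p) R ∈ 𝓝 (ContinuousMap.const K p) :=
      Metric.eball_mem_nhds _ ha.r_pos
    filter_upwards [this] with u hu s
    have hmem : u - ContinuousMap.const K p ∈ Metric.eball (0 : C(K, E)) R := by
      simpa [Metric.mem_eball, edist_eq_enorm_sub] using hu
    have h1 := q.hasSum (Metric.eball_subset_eball hRq hmem)
    have h2 := (ContinuousMap.evalCLM ℝ s : C(K, F) →L[ℝ] F).hasSum h1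
    have hmem' : u s - p ∈ Metric.eball (0 : E) R := by
      rw [Metric.mem_eball, edist_zero_right] at hmem ⊢
      refine lt_of_le_of_lt ?_ hmem
      rw [← ofReal_norm, ← ofReal_norm]
      exact ENNReal.ofReal_le_ofReal ((u - ContinuousMap.const K p).norm_coe_le_norm s)
    have h3 := ha.hasSum hmem'
    rw [add_sub_cancel] at h3
    exact h2.unique h3

end Superposition

/-! ### The rescaled integral equation and its analytic solution -/

section LocalFlow

open scoped unitInterval

variable {E : Type*} [NormedAddCommGroup E] [NormedSpace ℝ E] [CompleteSpace E]

/-- The operator `u ↦ (s ↦ ∫₀ˢ u)` on continuous functions on the unit interval. -/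
noncomputable def integralCLM (E : Type*) [NormedAddCommGroup E] [NormedSpace ℝ E]
    [CompleteSpace E] : C(I, E) →L[ℝ] C(I, E) :=
  LinearMap.mkContinuous
    { toFun := fun u => ⟨fun s => ∫ t in (0 : ℝ)..s, u (projIcc 0 1 zero_le_one t),
        (intervalIntegral.continuous_primitive (fun a b =>
          (u.continuous.comp continuous_projIcc).intervalIntegrable a b) 0).comp
            continuous_subtype_val⟩
      map_add' := fun u v => by
        ext s
        exact intervalIntegral.integral_add
          ((u.continuous.comp continuous_projIcc).intervalIntegrable _ _)
          ((v.continuous.comp continuous_projIcc).intervalIntegrable _ _)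
      map_smul' := fun c u => by
        ext s
        exact intervalIntegral.integral_smul c _ } 1 (by
      intro u
      refine (ContinuousMap.norm_le _ (by positivity)).2 fun s => ?_
      refine (intervalIntegral.norm_integral_le_of_norm_le_const (C := ‖u‖)
        fun t _ => u.norm_coe_le_norm _).trans ?_
      rw [sub_zero, abs_of_nonneg s.2.1, one_mul]
      exact mul_le_of_le_one_right (norm_nonneg _) s.2.2)

theorem integralCLM_apply (u : C(I, E)) (s : I) :
    integralCLM E u s = ∫ t in (0 : ℝ)..s, u (projIcc 0 1 zero_le_one t) := rfl

/-- Constant functions, as a continuous linear map. -/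
noncomputable def constCLM (K E : Type*) [TopologicalSpace K] [CompactSpace K]
    [NormedAddCommGroup E] [NormedSpace ℝ E] : E →L[ℝ] C(K, E) :=
  LinearMap.mkContinuous
    { toFun := fun x => ContinuousMap.const K x
      map_add' := fun _ _ => rfl
      map_smul' := fun _ _ => rfl } 1 (fun x => by
        rw [one_mul]
        exact (ContinuousMap.norm_le _ (norm_nonneg _)).2 fun s => le_rfl)

omit [CompleteSpace E] in
theorem constCLM_apply (K : Type*) [TopologicalSpace K] [CompactSpace K] (x : E) :
    constCLM K E x = ContinuousMap.const K x := rfl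

/-- The rescaled integral equation `u(s) = x + a ∫₀ˢ f(u)` near a constant function has a unique
solution, depending analytically on `(a, x)`. -/
theorem exists_analyticAt_solution {f : E → E} {p : E} (hf : AnalyticAt ℝ f p) :
    ∃ V : ℝ × E → C(I, E), AnalyticAt ℝ V (0, p) ∧
      ∀ᶠ v : (ℝ × E) × C(I, E) in 𝓝 ((0, p), ContinuousMap.const I p),
        (∀ s : I, v.2 s = v.1.2 +
          v.1.1 • ∫ t in (0 : ℝ)..s, f (v.2 (projIcc 0 1 zero_le_one t))) → V v.1 = v.2 := by
  obtain ⟨N, hN, hNf⟩ := exists_analyticAt_superposition (K := I) hf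
  -- Putting the time into the factor `a` fixes the interval to `[0, 1]`. At `a = 0` the equation is
  -- `u = x`, so its partial derivative in `u` is the identity.
  let G : (ℝ × E) × C(I, E) → C(I, E) := fun v =>
    v.2 - constCLM I E v.1.2 - v.1.1 • integralCLM E (N v.2)
  let u₀ : (ℝ × E) × C(I, E) := ((0, p), ContinuousMap.const I p)
  have hNu : AnalyticAt ℝ (fun v : (ℝ × E) × C(I, E) => N v.2) u₀ :=
    AnalyticAt.fun_comp (f := fun v : (ℝ × E) × C(I, E) => v.2) hN analyticAt_snd
  have hG : AnalyticAt ℝ G u₀ := by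
    have h1 : AnalyticAt ℝ (fun v : (ℝ × E) × C(I, E) => constCLM I E v.1.2) u₀ :=
      ((constCLM I E).analyticAt _).fun_comp (analyticAt_snd.fun_comp analyticAt_fst)
    have h2 : AnalyticAt ℝ (fun v : (ℝ × E) × C(I, E) => integralCLM E (N v.2)) u₀ :=
      ((integralCLM E).analyticAt _).fun_comp hNu
    have h3 : AnalyticAt ℝ (fun v : (ℝ × E) × C(I, E) => v.1.1) u₀ :=
      analyticAt_fst.fun_comp analyticAt_fst
    exact (analyticAt_snd.sub h1).sub (h3.smul h2)
  have hG0 : G u₀ = 0 := by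
    simp [G, u₀, constCLM_apply]
  have hGd : fderiv ℝ G u₀ ∘L ContinuousLinearMap.inr ℝ (ℝ × E) C(I, E)
      = ContinuousLinearMap.id ℝ C(I, E) := by
    have h1 : HasFDerivAt G (fderiv ℝ G u₀) ((0, p), ContinuousMap.const I p) :=
      hG.differentiableAt.hasFDerivAt
    have h2 := h1.comp (ContinuousMap.const I p)
      (hasFDerivAt_prodMk_right (𝕜 := ℝ) ((0 : ℝ), p) (ContinuousMap.const I p))
    have h3 : HasFDerivAt (G ∘ fun u => (((0 : ℝ), p), u)) (ContinuousLinearMap.id ℝ C(I, E))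
        (ContinuousMap.const I p) := by
      have : (G ∘ fun u => (((0 : ℝ), p), u)) = fun u => u - constCLM I E p := by
        ext u; simp [G]
      rw [this]
      exact (hasFDerivAt_id _).sub_const _
    exact h2.unique h3
  have hinv : (fderiv ℝ G u₀ ∘L ContinuousLinearMap.inr ℝ (ℝ × E) C(I, E)).IsInvertible := by
    rw [hGd]
    exact ⟨ContinuousLinearEquiv.refl ℝ _, rfl⟩
  have hc : ContDiffAt ℝ ω G u₀ := hG.contDiffAt
  refine ⟨hc.implicitFunction (by simp) hinv, ?_, ?_⟩
  · exact (hc.contDiffAt_implicitFunction (by simp) hinv).analyticAt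
  · have hev : ∀ᶠ v : (ℝ × E) × C(I, E) in 𝓝 u₀, ∀ s, N v.2 s = f (v.2 s) :=
      (continuous_snd.tendsto u₀).eventually hNf
    filter_upwards [hc.eventually_apply_eq_iff_implicitFunction (by simp) hinv, hev]
      with v hv hNv hsol
    refine hv.1 ?_
    rw [hG0]
    ext s
    simp only [G, ContinuousMap.sub_apply, ContinuousMap.smul_apply, constCLM_apply,
      ContinuousMap.const_apply, integralCLM_apply, hNv, ContinuousMap.zero_apply]
    rw [hsol s]; abel

end LocalFlow

/-! ### Uniqueness of solutions and the analytic local flow -/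

section LocalFlow

open scoped unitInterval

variable {E : Type*} [NormedAddCommGroup E] [NormedSpace ℝ E] [CompleteSpace E]

/-- Solutions of an autonomous analytic system on an interval are determined by one value. -/
theorem eqOn_of_isIntegralCurveOn {f : E → E} {U : Set E} (hf : AnalyticOnNhd ℝ f U)
    {φ ψ : ℝ → E} {S : Set ℝ} (hS : S.OrdConnected)
    (hφ : IsIntegralCurveOn φ (fun _ => f) S) (hψ : IsIntegralCurveOn ψ (fun _ => f) S)
    (hφU : MapsTo φ S U) (hψU : MapsTo ψ S U) {t₀ : ℝ} (ht₀ : t₀ ∈ S) (h : φ t₀ = ψ t₀) :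
    EqOn φ ψ S := by
  have key : ∀ a ∈ S, ∀ b ∈ S, ∃ K, LipschitzOnWith K f (φ '' Icc a b ∪ ψ '' Icc a b) := by
    intro a ha b hb
    have hsub : Icc a b ⊆ S := hS.out ha hb
    have hcomp : IsCompact (φ '' Icc a b ∪ ψ '' Icc a b) :=
      (isCompact_Icc.image_of_continuousOn (hφ.continuousOn.mono hsub)).union
        (isCompact_Icc.image_of_continuousOn (hψ.continuousOn.mono hsub))
    -- Uniqueness needs one Lipschitz constant only on the union of the two trajectories;
    -- compactness supplies it although `U` need not be convex.
    refine LocallyLipschitzOn.exists_lipschitzOnWith_of_compact hcomp ?_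
    intro x hx
    have hxU : x ∈ U := by
      rcases hx with ⟨t, ht, rfl⟩ | ⟨t, ht, rfl⟩
      · exact hφU (hsub ht)
      · exact hψU (hsub ht)
    obtain ⟨K, s, hs, hl⟩ :=
      ((hf x hxU).contDiffAt (n := 1)).exists_lipschitzOnWith
    exact ⟨K, s, mem_nhdsWithin_of_mem_nhds hs, hl⟩
  intro t ht
  rcases le_total t₀ t with hle | hle
  · obtain ⟨K, hK⟩ := key t₀ ht₀ t ht
    have hsub : Icc t₀ t ⊆ S := hS.out ht₀ ht
    have hd : ∀ χ : ℝ → E, IsIntegralCurveOn χ (fun _ => f) S →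
        ∀ s ∈ Ico t₀ t, HasDerivWithinAt χ (f (χ s)) (Ici s) s := fun χ hχ s hs =>
      ((hχ s (hsub (Ico_subset_Icc_self hs))).mono hsub).mono_of_mem_nhdsWithin
        (mem_of_superset (Icc_mem_nhdsGE_of_mem ⟨le_rfl, hs.2⟩) (Icc_subset_Icc_left hs.1))
    exact ODE_solution_unique_of_mem_Icc_right (v := fun _ => f) (fun s _ => hK)
      (hφ.continuousOn.mono hsub) (hd φ hφ)
      (fun s hs => Or.inl ⟨s, Ico_subset_Icc_self hs, rfl⟩)
      (hψ.continuousOn.mono hsub) (hd ψ hψ)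
      (fun s hs => Or.inr ⟨s, Ico_subset_Icc_self hs, rfl⟩) h (right_mem_Icc.2 hle)
  · obtain ⟨K, hK⟩ := key t ht t₀ ht₀
    have hsub : Icc t t₀ ⊆ S := hS.out ht ht₀
    have hd : ∀ χ : ℝ → E, IsIntegralCurveOn χ (fun _ => f) S →
        ∀ s ∈ Ioc t t₀, HasDerivWithinAt χ (f (χ s)) (Iic s) s := fun χ hχ s hs =>
      ((hχ s (hsub (Ioc_subset_Icc_self hs))).mono hsub).mono_of_mem_nhdsWithin
        (mem_of_superset (Icc_mem_nhdsLE_of_mem ⟨hs.1, le_rfl⟩) (Icc_subset_Icc_right hs.2))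
    exact ODE_solution_unique_of_mem_Icc_left (v := fun _ => f) (fun s _ => hK)
      (hφ.continuousOn.mono hsub) (hd φ hφ)
      (fun s hs => Or.inl ⟨s, Ioc_subset_Icc_self hs, rfl⟩)
      (hψ.continuousOn.mono hsub) (hd ψ hψ)
      (fun s hs => Or.inr ⟨s, Ioc_subset_Icc_self hs, rfl⟩) h (left_mem_Icc.2 hle)



/-- An analytic vector field has an analytic local flow. -/
theorem exists_local_flow {f : E → E} {U : Set E} {p : E} (hU : U ∈ 𝓝 p)
    (hf : AnalyticAt ℝ f p) :
    ∃ Φ : ℝ × E → E, AnalyticAt ℝ Φ (0, p) ∧ ∀ᶠ z : ℝ × E in 𝓝 (0, p),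
      Φ (0, z.2) = z.2 ∧ Φ z ∈ U ∧ HasDerivAt (fun t => Φ (t, z.2)) (f (Φ z)) z.1 := by
  obtain ⟨V, hV, hVs⟩ := exists_analyticAt_solution hf
  -- Picard–Lindelöf provides existence and continuity of the flow; analyticity follows by
  -- identifying it with the implicit solution `V`.
  obtain ⟨ε, hε, a, r, L, K, hr, hPL⟩ :=
    IsPicardLindelof.of_contDiffAt_one (hf.contDiffAt (n := 1))
  obtain ⟨α, hα, hαc⟩ :=
    (hPL 0).exists_forall_mem_closedBall_eq_hasDerivWithinAt_continuousOn
  simp only [zero_sub, zero_add] at hα hαc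
  have hr' : (0 : ℝ) < r := hr
  have hα0 : α (p, 0) = p := (hα p (mem_closedBall_self hr'.le)).1
  have hcont : ContinuousAt α (p, 0) := hαc.continuousAt
    (prod_mem_nhds (closedBall_mem_nhds p hr') (Icc_mem_nhds (by linarith) hε))
  obtain ⟨ρ, hρ, hρV⟩ := Metric.eventually_nhds_iff_ball.1 hVs
  have hgood : ∀ᶠ y in 𝓝 (α (p, 0)), y ∈ U ∧ ContinuousAt f y ∧ y ∈ ball p ρ := by
    rw [hα0]
    have h1 : ∀ᶠ y in 𝓝 p, ContinuousAt f y := by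
      filter_upwards [hf.eventually_analyticAt] with y hy using hy.continuousAt
    exact (eventually_mem_set.2 hU).and (h1.and (ball_mem_nhds p hρ))
  obtain ⟨η₀, hη₀, hη₀g⟩ := Metric.eventually_nhds_iff_ball.1 (hcont.eventually hgood)
  set η := min (min η₀ ρ) (min ε r) with hη
  have hηpos : 0 < η := by positivity
  have h1 : η ≤ η₀ := (min_le_left _ _).trans (min_le_left _ _)
  have h2 : η ≤ ρ := (min_le_left _ _).trans (min_le_right _ _)
  have h3 : η ≤ ε := (min_le_right _ _).trans (min_le_left _ _)
  have h4 : η ≤ r := (min_le_right _ _).trans (min_le_right _ _)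
  have hbox : ∀ x ∈ ball p η, ∀ t ∈ Ioo (-η) η,
      α (x, t) ∈ U ∧ ContinuousAt f (α (x, t)) ∧ α (x, t) ∈ ball p ρ := by
    intro x hx t ht
    refine hη₀g (x, t) ?_
    rw [← ball_prod_same]
    refine ⟨ball_subset_ball h1 hx, ?_⟩
    rw [Real.ball_eq_Ioo]
    exact ⟨by linarith [ht.1], by linarith [ht.2]⟩
  have hder : ∀ x ∈ ball p η, ∀ t ∈ Ioo (-η) η,
      HasDerivAt (fun t => α (x, t)) (f (α (x, t))) t := by
    intro x hx t ht
    have hx' : x ∈ closedBall p r := ball_subset_closedBall (ball_subset_ball h4 hx)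
    exact ((hα x hx').2 t ⟨by linarith [ht.1], by linarith [ht.2]⟩).hasDerivAt
      (Icc_mem_nhds (by linarith [ht.1]) (by linarith [ht.2]))
  -- The rescaled trajectory `s ↦ α (x, t * s)` solves the integral equation with `a = t` and stays
  -- uniformly near `p`, so it equals `V (t, x)`; evaluate at `s = 1`.
  have hVα : ∀ x ∈ ball p η, ∀ t ∈ Ioo (-η) η, V (t, x) 1 = α (x, t) := by
    intro x hx t ht
    have hmem : ∀ w ∈ Icc (0 : ℝ) 1, t * w ∈ Ioo (-η) η := by
      intro w hw
      have : |t * w| < η := by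
        rw [abs_mul, abs_of_nonneg hw.1]
        exact (mul_le_of_le_one_right (abs_nonneg _) hw.2).trans_lt (abs_lt.2 ht)
      exact abs_lt.1 this
    have hg : ∀ w ∈ Icc (0 : ℝ) 1,
        HasDerivAt (fun w => α (x, t * w)) (t • f (α (x, t * w))) w := by
      intro w hw
      have hm : HasDerivAt (fun w : ℝ => t * w) t w := by
        simpa using (hasDerivAt_id w).const_mul t
      exact (hder x hx (t * w) (hmem w hw)).scomp w hm
    let u : C(I, E) := ⟨fun s => α (x, t * s), by
      refine continuous_iff_continuousAt.2 fun s => ?_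
      exact ContinuousAt.comp (f := ((↑) : I → ℝ)) (hg s s.2).continuousAt
        continuous_subtype_val.continuousAt⟩
    have hsol := hρV ((t, x), u) (by
      rw [← ball_prod_same, ← ball_prod_same]
      refine ⟨⟨?_, ball_subset_ball h2 hx⟩, ?_⟩
      · rw [Real.ball_eq_Ioo]
        exact ⟨by linarith [ht.1], by linarith [ht.2]⟩
      · exact (ContinuousMap.dist_lt_iff hρ).2 fun s => (hbox x hx _ (hmem s s.2)).2.2) (by
      intro s
      have hcongr : EqOn (fun w => f (u (projIcc 0 1 zero_le_one w)))
          (fun w => f (α (x, t * w))) (uIcc (0 : ℝ) s) := by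
        intro w hw
        rw [uIcc_of_le s.2.1] at hw
        simp only [u, ContinuousMap.coe_mk]
        rw [projIcc_of_mem zero_le_one ⟨hw.1, hw.2.trans s.2.2⟩]
      have hsub : uIcc (0 : ℝ) s ⊆ Icc 0 1 := by
        rw [uIcc_of_le s.2.1]; exact Icc_subset_Icc_right s.2.2
      simp only
      rw [intervalIntegral.integral_congr hcongr, ← intervalIntegral.integral_smul,
        intervalIntegral.integral_eq_sub_of_hasDerivAt (fun w hw => hg w (hsub hw))]
      · have : α (x, 0) = x := (hα x (ball_subset_closedBall (ball_subset_ball h4 hx))).1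
        simp [u, this]
      · refine ContinuousOn.intervalIntegrable fun w hw => ?_
        refine ContinuousAt.continuousWithinAt ?_
        refine continuousAt_const.smul ?_
        exact ContinuousAt.comp (f := fun w => α (x, t * w))
          (hbox x hx _ (hmem w (hsub hw))).2.1 (hg w (hsub hw)).continuousAt)
    have hsol' : V (t, x) = u := hsol
    rw [hsol']
    simp [u]
  have hnhds : Ioo (-η) η ×ˢ ball p η ∈ 𝓝 ((0 : ℝ), p) :=
    prod_mem_nhds (Ioo_mem_nhds (by linarith) hηpos) (ball_mem_nhds p hηpos)
  refine ⟨fun z => α (z.2, z.1), ?_, ?_⟩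
  · have h5 : AnalyticAt ℝ (fun z => V z 1) (0, p) :=
      ((ContinuousMap.evalCLM ℝ (1 : I) : C(I, E) →L[ℝ] E).analyticAt _).fun_comp hV
    refine h5.congr ?_
    filter_upwards [hnhds] with z hz using hVα z.2 hz.2 z.1 hz.1
  · filter_upwards [hnhds] with z hz
    exact ⟨(hα z.2 (ball_subset_closedBall (ball_subset_ball h4 hz.2))).1,
      (hbox z.2 hz.2 z.1 hz.1).1, hder z.2 hz.2 z.1 hz.1⟩

end LocalFlow

/-! ### Continuation of the analytic flow along an integral curve -/

section Flow

variable {E : Type*} [NormedAddCommGroup E] [NormedSpace ℝ E] [FiniteDimensional ℝ E]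

/-- `Φ` is, near the point `z = (t, x)`, an analytic orientation-preserving flow of `f` in `U`. -/
structure IsFlowAt (f : E → E) (U : Set E) (Φ : ℝ × E → E) (z : ℝ × E) : Prop where
  analyticAt : AnalyticAt ℝ Φ z
  mem : Φ z ∈ U
  hasDerivAt : HasDerivAt (fun t => Φ (t, z.2)) (f (Φ z)) z.1
  det_pos : 0 < (fderiv ℝ (fun x => Φ (z.1, x)) z.2).det

/-- `Φ` is an analytic flow of `f` on the times in `(a, b)` and the initial conditions in the ball
of radius `δ` around `p`. -/
structure IsAnalyticFlow (f : E → E) (U : Set E) (p : E) (Φ : ℝ × E → E) (a b δ : ℝ) :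
    Prop where
  init : ∀ x ∈ ball p δ, Φ (0, x) = x
  isFlowAt : ∀ z ∈ Ioo a b ×ˢ ball p δ, IsFlowAt f U Φ z

omit [FiniteDimensional ℝ E] in
theorem IsFlowAt.congr {f : E → E} {U : Set E} {Φ Ψ : ℝ × E → E} {z : ℝ × E}
    (h : IsFlowAt f U Φ z) (he : Ψ =ᶠ[𝓝 z] Φ) : IsFlowAt f U Ψ z := by
  have h1 : (fun t => Ψ (t, z.2)) =ᶠ[𝓝 z.1] fun t => Φ (t, z.2) :=
    (Continuous.prodMk_left z.2).continuousAt.eventually (f := fun t : ℝ => (t, z.2)) he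
  have h2 : (fun x => Ψ (z.1, x)) =ᶠ[𝓝 z.2] fun x => Φ (z.1, x) :=
    (Continuous.prodMk_right z.1).continuousAt.eventually (f := fun x : E => (z.1, x)) he
  refine ⟨h.analyticAt.congr he.symm, he.eq_of_nhds ▸ h.mem, ?_, ?_⟩
  · rw [he.eq_of_nhds]
    exact h.hasDerivAt.congr_of_eventuallyEq h1
  · rw [h2.fderiv_eq]
    exact h.det_pos

omit [FiniteDimensional ℝ E] in
theorem IsAnalyticFlow.mono {f : E → E} {U : Set E} {p : E} {Φ : ℝ × E → E} {a b δ a' b' δ' : ℝ}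
    (h : IsAnalyticFlow f U p Φ a b δ) (ha : a ≤ a') (hb : b' ≤ b) (hδ : δ' ≤ δ) :
    IsAnalyticFlow f U p Φ a' b' δ' :=
  ⟨fun x hx => h.init x (ball_subset_ball hδ hx), fun z hz =>
    h.isFlowAt z ⟨Ioo_subset_Ioo ha hb hz.1, ball_subset_ball hδ hz.2⟩⟩

omit [FiniteDimensional ℝ E] in
theorem IsAnalyticFlow.isIntegralCurveOn {f : E → E} {U : Set E} {p : E} {Φ : ℝ × E → E}
    {a b δ : ℝ} (h : IsAnalyticFlow f U p Φ a b δ) {x : E} (hx : x ∈ ball p δ) :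
    IsIntegralCurveOn (fun t => Φ (t, x)) (fun _ => f) (Ioo a b) := fun t ht =>
  (h.isFlowAt (t, x) ⟨ht, hx⟩).hasDerivAt.hasDerivWithinAt

/-- At time `0` the spatial derivative of the flow is the identity, so by continuity its determinant
stays positive on a small box. -/
theorem exists_isAnalyticFlow_local {f : E → E} {U : Set E} {p : E} (hU : U ∈ 𝓝 p)
    (hf : AnalyticAt ℝ f p) :
    ∃ ε > 0, ∃ δ > 0, ∃ Φ : ℝ × E → E, IsAnalyticFlow f U p Φ (-ε) ε δ := by
  have := FiniteDimensional.complete ℝ E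
  obtain ⟨Φ, hΦ, hev⟩ := exists_local_flow hU hf
  have hslice : ∀ z : ℝ × E, AnalyticAt ℝ Φ z → fderiv ℝ (fun x => Φ (z.1, x)) z.2
      = fderiv ℝ Φ z ∘L ContinuousLinearMap.inr ℝ ℝ E := fun z hz =>
    ((show HasFDerivAt Φ (fderiv ℝ Φ z) (z.1, z.2) from
      hz.differentiableAt.hasFDerivAt).comp z.2 (hasFDerivAt_prodMk_right z.1 z.2)).fderiv
  have hid : fderiv ℝ Φ (0, p) ∘L ContinuousLinearMap.inr ℝ ℝ E = ContinuousLinearMap.id ℝ E := by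
    rw [← hslice (0, p) hΦ]
    have : (fun x => Φ ((0 : ℝ), x)) =ᶠ[𝓝 p] fun x => x := by
      filter_upwards [(Continuous.prodMk_right (0 : ℝ)).continuousAt.eventually
        (f := fun x : E => ((0 : ℝ), x)) hev] with x hx using hx.1
    simp only
    rw [this.fderiv_eq]
    exact fderiv_fun_id
  have hdet : ∀ᶠ z in 𝓝 ((0 : ℝ), p),
      0 < (fderiv ℝ Φ z ∘L ContinuousLinearMap.inr ℝ ℝ E).det := by
    have hc : ContinuousAt (fun z => (fderiv ℝ Φ z ∘L ContinuousLinearMap.inr ℝ ℝ E).det)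
        (0, p) := by
      have h1 : ContinuousAt (fderiv ℝ Φ) (0, p) := hΦ.fderiv.continuousAt
      exact ContinuousLinearMap.continuous_det.continuousAt.comp
        (h1.clm_comp continuousAt_const)
    refine hc.eventually (lt_mem_nhds ?_)
    simp only [hid]
    simp [ContinuousLinearMap.det]
  have hall := hev.and (hΦ.eventually_analyticAt.and hdet)
  obtain ⟨ε, hε, hb⟩ := Metric.eventually_nhds_iff_ball.1 hall
  refine ⟨ε, hε, ε, hε, Φ, ?_⟩
  have hbox : ∀ z ∈ Ioo (-ε) ε ×ˢ ball p ε, z ∈ ball ((0 : ℝ), p) ε := by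
    rintro z ⟨h1, h2⟩
    rw [← ball_prod_same]
    refine ⟨?_, h2⟩
    rwa [Real.ball_eq_Ioo, zero_sub, zero_add]
  refine ⟨fun x hx => (hb _ (hbox (0, x) ⟨⟨by simpa using hε, hε⟩, hx⟩)).1.1, fun z hz => ?_⟩
  obtain ⟨⟨h1, h2, h3⟩, h4, h5⟩ := hb z (hbox z hz)
  exact ⟨h4, h2, h3, by rw [hslice z h4]; exact h5⟩

/-- Two analytic flows can be concatenated. -/
theorem IsAnalyticFlow.extend {f : E → E} {U : Set E} (hf : AnalyticOnNhd ℝ f U) {p q : E}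
    {Φ Ψ : ℝ × E → E} {a b c δ η δ' : ℝ} (hΦ : IsAnalyticFlow f U p Φ a b δ)
    (hΨ : IsAnalyticFlow f U q Ψ (-η) η δ') (ha : a < 0) (hc : 0 ≤ c) (hcb : c < b) (hδ : 0 < δ)
    (hη : 0 < η) (hq : Φ (c, p) ∈ ball q δ') :
    ∃ δ'' > 0, ∃ Φ' : ℝ × E → E, IsAnalyticFlow f U p Φ' a (c + η) δ'' := by
  have := FiniteDimensional.complete ℝ E
  have hcont : ContinuousAt (fun x => Φ (c, x)) p :=
    ContinuousAt.comp (f := fun x : E => (c, x))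
      (hΦ.isFlowAt (c, p) ⟨⟨by linarith, hcb⟩, mem_ball_self hδ⟩).analyticAt.continuousAt
      (Continuous.prodMk_right c).continuousAt
  obtain ⟨ρ, hρ, hρb⟩ := Metric.eventually_nhds_iff_ball.1
    (hcont.eventually (isOpen_ball.mem_nhds hq))
  set μ := min (min η (b - c)) (c - a) with hμ
  have hμ0 : 0 < μ := lt_min (lt_min hη (by linarith)) (by linarith)
  have hμ1 : μ ≤ η := (min_le_left _ _).trans (min_le_left _ _)
  have hμ2 : μ ≤ b - c := (min_le_left _ _).trans (min_le_right _ _)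
  have hμ3 : μ ≤ c - a := min_le_right _ _
  set r := min δ ρ
  have hrδ : ball p r ⊆ ball p δ := ball_subset_ball (min_le_left _ _)
  have hrρ : ball p r ⊆ ball p ρ := ball_subset_ball (min_le_right _ _)
  -- The two pieces coincide on a window around `c`, so the piecewise definition below remains
  -- analytic across `t = c`.
  have hagree : ∀ x ∈ ball p r, EqOn (fun t => Φ (t, x)) (fun t => Ψ (t - c, Φ (c, x)))
      (Ioo (c - μ) (c + μ)) := by
    intro x hx
    have hsub : Ioo (c - μ) (c + μ) ⊆ Ioo a b := Ioo_subset_Ioo (by linarith) (by linarith)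
    have hmemΨ : ∀ t ∈ Ioo (c - μ) (c + μ), (t - c, Φ (c, x)) ∈ Ioo (-η) η ×ˢ ball q δ' :=
      fun t ht => ⟨⟨by linarith [ht.1], by linarith [ht.2]⟩, hρb x (hrρ hx)⟩
    refine eqOn_of_isIntegralCurveOn hf ordConnected_Ioo
      ((hΦ.isIntegralCurveOn (hrδ hx)).mono hsub) ?_
      (fun t ht => (hΦ.isFlowAt (t, x) ⟨hsub ht, hrδ hx⟩).mem)
      (fun t ht => (hΨ.isFlowAt _ (hmemΨ t ht)).mem) (t₀ := c)
      ⟨by linarith, by linarith⟩ ?_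
    · intro t ht
      exact ((hΨ.isFlowAt _ (hmemΨ t ht)).hasDerivAt.comp_sub_const t c).hasDerivWithinAt
    · simp only [sub_self]
      rw [hΨ.init _ (hρb x (hrρ hx))]
  let Φ' : ℝ × E → E := fun z => if z.1 ≤ c then Φ z else Ψ (z.1 - c, Φ (c, z.2))
  have hleft : ∀ z ∈ Ioo a (c + μ) ×ˢ ball p r, Φ' z = Φ z := by
    rintro ⟨t, x⟩ ⟨ht, hx⟩
    by_cases htc : t ≤ c
    · simp [Φ', htc]
    · simp only [Φ', htc, if_false]
      exact (hagree x hx ⟨by linarith, ht.2⟩).symm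
  refine ⟨r, lt_min hδ hρ, Φ', ⟨fun x hx => ?_, ?_⟩⟩
  · rw [hleft (0, x) ⟨⟨ha, by linarith⟩, hx⟩]
    exact hΦ.init x (hrδ hx)
  rintro ⟨t, x⟩ ⟨ht, hx⟩
  by_cases htc : t ≤ c
  · refine (hΦ.isFlowAt (t, x) ⟨⟨ht.1, by linarith⟩, hrδ hx⟩).congr ?_
    filter_upwards [prod_mem_nhds (Ioo_mem_nhds ht.1 (show t < c + μ by linarith))
      (isOpen_ball.mem_nhds hx)] with z hz using hleft z hz
  · rw [not_le] at htc
    have hflow : IsFlowAt f U (fun z => Ψ (z.1 - c, Φ (c, z.2))) (t, x) := by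
      have hΦx := hΦ.isFlowAt (c, x) ⟨⟨by linarith, hcb⟩, hrδ hx⟩
      have hΨx := hΨ.isFlowAt (t - c, Φ (c, x))
        ⟨⟨by linarith, by linarith [ht.2]⟩, hρb x (hrρ hx)⟩
      have hsec : AnalyticAt ℝ (fun y => Φ (c, y)) x :=
        hΦx.analyticAt.fun_comp (f := fun y : E => (c, y)) (analyticAt_const.prod analyticAt_id)
      have hsec' : AnalyticAt ℝ (fun y => Ψ (t - c, y)) (Φ (c, x)) :=
        hΨx.analyticAt.fun_comp (f := fun y : E => (t - c, y))
          (analyticAt_const.prod analyticAt_id)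
      refine ⟨?_, hΨx.mem, hΨx.hasDerivAt.comp_sub_const t c, ?_⟩
      · refine hΨx.analyticAt.fun_comp (f := fun z : ℝ × E => (z.1 - c, Φ (c, z.2)))
          (x := (t, x)) ((analyticAt_fst.sub analyticAt_const).prod ?_)
        exact hsec.fun_comp (f := fun z : ℝ × E => z.2) (x := (t, x)) analyticAt_snd
      · have hcomp := fderiv_comp x hsec'.differentiableAt hsec.differentiableAt
        simp only [Function.comp_def] at hcomp
        simp only
        rw [hcomp]
        -- Multiplicativity of the determinant carries positivity through the concatenation.
        have : ∀ A B : E →L[ℝ] E, (A ∘L B).det = A.det * B.det := fun A B =>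
          LinearMap.det_comp (A : E →ₗ[ℝ] E) (B : E →ₗ[ℝ] E)
        rw [this]
        exact mul_pos hΨx.det_pos hΦx.det_pos
    refine hflow.congr ?_
    filter_upwards [prod_mem_nhds (Ioi_mem_nhds htc) univ_mem] with z hz
    have : ¬ z.1 ≤ c := not_le.2 hz.1
    simp [Φ', this]

/-- An analytic vector field has an analytic flow along any of its integral curves. -/
theorem exists_isAnalyticFlow {f : E → E} {U : Set E} (hU : IsOpen U) (hf : AnalyticOnNhd ℝ f U)
    {γ : ℝ → E} (hγ : IsIntegralCurve γ (fun _ => f)) (hγU : ∀ t, γ t ∈ U) (T : ℝ) :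
    ∃ ε > 0, ∃ δ > 0, ∃ Φ : ℝ × E → E, IsAnalyticFlow f U (γ 0) Φ (-ε) (T + ε) δ := by
  have := FiniteDimensional.complete ℝ E
  let S : Set ℝ := {T | 0 ≤ T ∧ ∃ ε > 0, ∃ δ > 0, ∃ Φ : ℝ × E → E,
    IsAnalyticFlow f U (γ 0) Φ (-ε) (T + ε) δ}
  have h0 : (0 : ℝ) ∈ S := by
    obtain ⟨ε, hε, δ, hδ, Φ, hΦ⟩ :=
      exists_isAnalyticFlow_local (hU.mem_nhds (hγU 0)) (hf _ (hγU 0))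
    exact ⟨le_rfl, ε, hε, δ, hδ, Φ, by rwa [zero_add]⟩
  by_contra hcon
  -- A flow reaching beyond `T` restricts to one reaching `T`, so failure at `T` bounds `S`.
  have hub : ∀ t ∈ S, t ≤ T := by
    rintro t ⟨ht0, ε, hε, δ, hδ, Φ, hΦ⟩
    by_contra htT
    rw [not_le] at htT
    exact hcon ⟨ε, hε, δ, hδ, Φ, hΦ.mono le_rfl (by linarith) le_rfl⟩
  set c := sSup S
  have hlub : IsLUB S c := isLUB_csSup ⟨0, h0⟩ ⟨T, hub⟩
  obtain ⟨η, hη, δ', hδ', Ψ, hΨ⟩ :=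
    exists_isAnalyticFlow_local (hU.mem_nhds (hγU c)) (hf _ (hγU c))
  obtain ⟨ρ, hρ, hρb⟩ := Metric.eventually_nhds_iff_ball.1
    (hγ.continuous.continuousAt.eventually (ball_mem_nhds (γ c) hδ'))
  have hm : 0 < min ρ (η / 2) := lt_min hρ (by linarith)
  obtain ⟨t, ⟨ht0, ε, hε, δ, hδ, Φ, hΦ⟩, htc, htc'⟩ :=
    hlub.exists_between (sub_lt_self c hm)
  have hΦγ : Φ (t, γ 0) = γ t := by
    have := eqOn_of_isIntegralCurveOn hf (ordConnected_Ioo (a := -ε) (b := t + ε))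
      (hΦ.isIntegralCurveOn (mem_ball_self hδ)) (hγ.isIntegralCurveOn _)
      (fun s hs => (hΦ.isFlowAt (s, γ 0) ⟨hs, mem_ball_self hδ⟩).mem) (fun s _ => hγU s)
      (t₀ := 0) ⟨by linarith, by linarith⟩ (hΦ.init _ (mem_ball_self hδ))
    exact this ⟨by linarith, by linarith⟩
  obtain ⟨δ'', hδ'', Φ', hΦ'⟩ := hΦ.extend hf hΨ (by linarith) ht0 (by linarith) hδ hη (by
    rw [hΦγ]
    refine hρb t ?_
    rw [Real.ball_eq_Ioo]
    exact ⟨by linarith [min_le_left ρ (η / 2)], by linarith⟩)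
  -- `t` lies within `η / 2` below the supremum and the new flow reaches `t + η`, so this member of
  -- `S` exceeds `sSup S`.
  have hmem : t + η / 2 ∈ S := by
    refine ⟨by linarith, min ε (η / 2), lt_min hε (by linarith), δ'', hδ'', Φ', ?_⟩
    exact hΦ'.mono (by linarith [min_le_left ε (η / 2)]) (by linarith [min_le_right ε (η / 2)])
      le_rfl
  linarith [hlub.1 hmem, min_le_right ρ (η / 2)]

end Flow

/-! ### One-variable analysis: local inverses, even roots, the involution -/

section OneVariable

theorem analyticAt_rpow_const {k : ℝ → ℝ} {x : ℝ} (hk : AnalyticAt ℝ k x) (h : 0 < k x) (c : ℝ) :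
    AnalyticAt ℝ (fun t => k t ^ c) x := by
  have hc : ContDiffAt ℝ ω (fun t => k t ^ c) x :=
    hk.contDiffAt.rpow_const_of_ne h.ne'
  exact hc.analyticAt

/-- The local inverse of an analytic function of one variable, at a zero. -/
theorem exists_analyticAt_inverse {a : ℝ → ℝ} (ha : AnalyticAt ℝ a 0) (h0 : a 0 = 0)
    (hd : deriv a 0 ≠ 0) :
    ∃ b : ℝ → ℝ, AnalyticAt ℝ b 0 ∧ b 0 = 0 ∧ deriv b 0 = (deriv a 0)⁻¹ ∧
      (∀ᶠ y in 𝓝 0, a (b y) = y) ∧ ∀ᶠ t in 𝓝 0, b (a t) = t := by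
  have hs := ha.hasStrictDerivAt
  refine ⟨hs.localInverse _ _ _ hd, ?_, ?_, ?_, ?_, ?_⟩
  · have := ha.analyticAt_localInverse hd
    rwa [h0] at this
  · have : hs.localInverse _ _ _ hd (a 0) = 0 := HasStrictFDerivAt.localInverse_apply_image ..
    rwa [h0] at this
  · have := (hs.to_localInverse hd).hasDerivAt.deriv
    rwa [h0] at this
  · have : ∀ᶠ y in 𝓝 (a 0), a (hs.localInverse _ _ _ hd y) = y :=
      HasStrictDerivAt.eventually_right_inverse ..
    rwa [h0] at this
  · exact HasStrictDerivAt.eventually_left_inverse ..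

theorem exists_strictMonoOn {a : ℝ → ℝ} (ha : AnalyticAt ℝ a 0) (hd : 0 < deriv a 0) :
    ∃ κ > 0, StrictMonoOn a (Ioo (-κ) κ) := by
  have h1 : ∀ᶠ t in 𝓝 (0 : ℝ), 0 < deriv a t :=
    ha.deriv.continuousAt.eventually (lt_mem_nhds hd)
  obtain ⟨κ, hκ, h⟩ := Metric.eventually_nhds_iff_ball.1 (h1.and ha.eventually_analyticAt)
  rw [Real.ball_eq_Ioo, zero_sub, zero_add] at h
  refine ⟨κ, hκ, strictMonoOn_of_deriv_pos (convex_Ioo _ _)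
    (fun t ht => (h t ht).2.continuousAt.continuousWithinAt) fun t ht => ?_⟩
  rw [interior_Ioo] at ht
  exact (h t ht).1

/-- If `a < b`, dividing by `|t ^ a|` leaves a right side tending to `0` and a left side tending to
`|A 0| > 0`. Used in both directions, it shows that comparable functions vanish to the same order.
-/
theorem le_of_eventually_pow_mul_le {a b : ℕ} {A B : ℝ → ℝ} {C : ℝ} (hA : ContinuousAt A 0)
    (hB : ContinuousAt B 0) (hA0 : A 0 ≠ 0)
    (h : ∀ᶠ t in 𝓝 (0 : ℝ), |t ^ a * A t| ≤ C * |t ^ b * B t|) : b ≤ a := by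
  by_contra hab
  rw [not_le] at hab
  have hlim : Tendsto (fun t : ℝ => C * |t ^ (b - a) * B t|) (𝓝[≠] 0) (𝓝 0) := by
    have : ContinuousAt (fun t : ℝ => C * |t ^ (b - a) * B t|) 0 := by fun_prop
    have h2 := this.tendsto
    simp only [zero_pow (Nat.sub_ne_zero_of_lt hab), zero_mul, abs_zero, mul_zero] at h2
    exact h2.mono_left nhdsWithin_le_nhds
  have hlimA : Tendsto (fun t => |A t|) (𝓝[≠] 0) (𝓝 |A 0|) :=
    hA.abs.tendsto.mono_left nhdsWithin_le_nhds
  have hle : |A 0| ≤ 0 := by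
    refine le_of_tendsto_of_tendsto hlimA hlim ?_
    filter_upwards [nhdsWithin_le_nhds h, self_mem_nhdsWithin] with t ht hne
    have htpos : 0 < |t ^ a| := abs_pos.2 (pow_ne_zero _ hne)
    have hsplit : t ^ b = t ^ a * t ^ (b - a) := by
      rw [← pow_add, Nat.add_sub_cancel' hab.le]
    rw [hsplit, mul_assoc, abs_mul, abs_mul (t ^ a)] at ht
    refine le_of_mul_le_mul_left ?_ htpos
    linarith
  exact hA0 (abs_nonpos_iff.1 hle)

/-- A function comparable with `-g`, where `g ≥ 0` vanishes to order `2n`, is minus the `2n`-th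
power of a local analytic coordinate. -/
theorem exists_analyticAt_root {g e : ℝ → ℝ} {n : ℕ} (hn : 1 ≤ n)
    (hg : analyticOrderAt g 0 = (2 * n : ℕ)) (he : AnalyticAt ℝ e 0)
    (hg0 : ∀ᶠ t in 𝓝 0, 0 ≤ g t) (hge : ∀ᶠ t in 𝓝 0, |g t + e t| ≤ 2⁻¹ * |e t|) :
    ∃ w : ℝ → ℝ, AnalyticAt ℝ w 0 ∧ w 0 = 0 ∧ 0 < deriv w 0 ∧
      ∀ᶠ t in 𝓝 0, e t = -(w t) ^ (2 * n) := by
  have hga : AnalyticAt ℝ g 0 := by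
    refine (analyticOrderAt_ne_zero.1 ?_).1
    rw [hg]
    exact_mod_cast (by omega : 2 * n ≠ 0)
  obtain ⟨G, hGa, hG0, hG⟩ := (hga.analyticOrderAt_eq_natCast).1 hg
  have h1 : ∀ᶠ t in 𝓝 0, |g t| ≤ 3 / 2 * |e t| := by
    filter_upwards [hge] with t ht
    have := abs_sub_abs_le_abs_sub (g t) (-e t)
    rw [sub_neg_eq_add, abs_neg] at this
    linarith
  have h2 : ∀ᶠ t in 𝓝 0, |e t| ≤ 2 * |g t| := by
    filter_upwards [hge] with t ht
    have := abs_sub_abs_le_abs_sub (-e t) (g t)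
    rw [abs_neg, show -e t - g t = -(g t + e t) by ring, abs_neg] at this
    linarith
  have hne : analyticOrderAt e 0 ≠ ⊤ := by
    intro htop
    rw [analyticOrderAt_eq_top] at htop
    have : analyticOrderAt g 0 = ⊤ := by
      rw [analyticOrderAt_eq_top]
      filter_upwards [htop, h1] with t ht h
      simpa [ht] using h
    rw [hg] at this
    exact ENat.natCast_ne_top _ this
  obtain ⟨H, hHa, hH0, hH⟩ := (he.analyticOrderAt_ne_top).1 hne
  set m := analyticOrderNatAt e 0
  simp only [sub_zero, smul_eq_mul] at hH hG
  have hm : m = 2 * n := by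
    refine le_antisymm ?_ ?_
    · refine le_of_eventually_pow_mul_le (C := 3 / 2) hGa.continuousAt hHa.continuousAt hG0 ?_
      filter_upwards [hH, hG, h1] with t e1 e2 e3
      rwa [← e1, ← e2]
    · refine le_of_eventually_pow_mul_le (C := 2) hHa.continuousAt hGa.continuousAt hH0 ?_
      filter_upwards [hH, hG, h2] with t e1 e2 e3
      rwa [← e1, ← e2]
  rw [hm] at hH
  have hHneg : 0 < -H 0 := by
    refine lt_of_le_of_ne ?_ (neg_ne_zero.2 hH0).symm
    refine ge_of_tendsto (hHa.neg.continuousAt.tendsto.mono_left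
      (nhdsWithin_le_nhds (s := {0}ᶜ))) ?_
    filter_upwards [nhdsWithin_le_nhds hH, nhdsWithin_le_nhds hge, nhdsWithin_le_nhds hg0,
      self_mem_nhdsWithin] with t e1 e2 e3 ht
    have hpos : 0 < t ^ (2 * n) := (even_two_mul n).pow_pos ht
    -- If `e t > 0`, then `g t ≥ 0` gives `|g t + e t| ≥ e t`, against the factor `1/2`.
    have hle : e t ≤ 0 := by
      by_contra hcon
      rw [not_le] at hcon
      rw [abs_of_pos hcon, abs_of_nonneg (by linarith)] at e2
      linarith
    rw [e1] at hle
    have : H t ≤ 0 := by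
      by_contra hcon
      rw [not_le] at hcon
      linarith [mul_pos hpos hcon]
    simpa using this
  have hroot : AnalyticAt ℝ (fun t => (-H t) ^ ((2 * n : ℕ) : ℝ)⁻¹) 0 :=
    analyticAt_rpow_const hHa.neg hHneg _
  refine ⟨fun t => t * (-H t) ^ ((2 * n : ℕ) : ℝ)⁻¹, analyticAt_id.mul hroot, by simp, ?_, ?_⟩
  · have : HasDerivAt (fun t => t * (-H t) ^ ((2 * n : ℕ) : ℝ)⁻¹)
        (1 * (-H 0) ^ ((2 * n : ℕ) : ℝ)⁻¹ + 0 * deriv (fun t => (-H t) ^ ((2 * n : ℕ) : ℝ)⁻¹) 0)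
        0 := (hasDerivAt_id (0 : ℝ)).mul hroot.differentiableAt.hasDerivAt
    rw [this.deriv, one_mul, zero_mul, add_zero]
    exact Real.rpow_pos_of_pos hHneg _
  · filter_upwards [hH, hHa.neg.continuousAt.eventually (lt_mem_nhds hHneg)] with t e1 e2
    have e3 : 0 ≤ -H t := le_of_lt e2
    rw [mul_pow, Real.rpow_inv_natCast_pow e3 (by omega), e1]
    ring

/-- The half-return in the local coordinate: the equation `e (t₂) = π (e (t))` with `t₂` and `t`
on different sides of `0` is solved by an analytic function. -/
theorem exists_analyticAt_involution {w e q : ℝ → ℝ} {n : ℕ} (hn : 1 ≤ n)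
    (hw : AnalyticAt ℝ w 0) (hw0 : w 0 = 0) (hwd : 0 < deriv w 0) (he : AnalyticAt ℝ e 0)
    (hew : ∀ᶠ t in 𝓝 0, e t = -(w t) ^ (2 * n)) (hq : AnalyticAt ℝ q 0) (hq0 : q 0 = 0)
    (hqd : 0 < deriv q 0) :
    ∃ σ : ℝ → ℝ, AnalyticAt ℝ σ 0 ∧ σ 0 = 0 ∧ (∀ᶠ t in 𝓝 0, 0 < t → σ t < 0) ∧
      ∀ᶠ t in 𝓝 0, e (σ t) = q (e t) := by
  have he0 : e 0 = 0 := by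
    rw [hew.self_of_nhds, hw0, zero_pow (by omega), neg_zero]
  -- Factoring `q h = h * k h` with `k 0 = q' 0 > 0` makes `q (e t)` equal to `-(w t) ^ (2n)` times
  -- a positive factor whose root is analytic.
  obtain ⟨k, hk, hqk⟩ : ∃ k : ℝ → ℝ, AnalyticAt ℝ k 0 ∧ ∀ᶠ h in 𝓝 0, q h = h * k h := by
    have h1 : ((1 : ℕ) : ℕ∞) ≤ analyticOrderAt q 0 := by
      rw [Nat.cast_one]
      exact Order.one_le_iff_ne_zero.2 (analyticOrderAt_ne_zero.2 ⟨hq, hq0⟩)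
    obtain ⟨k, hk, hk'⟩ := (natCast_le_analyticOrderAt hq).1 h1
    exact ⟨k, hk, by simpa using hk'⟩
  have hk0 : 0 < k 0 := by
    have h1 : HasDerivAt (fun h => h * k h) (1 * k 0 + 0 * deriv k 0) 0 :=
      (hasDerivAt_id (0 : ℝ)).mul hk.differentiableAt.hasDerivAt
    have h2 : deriv q 0 = 1 * k 0 + 0 * deriv k 0 :=
      (h1.congr_of_eventuallyEq hqk).deriv
    linarith
  obtain ⟨v, hv, hv0, hvd, hwv, -⟩ := exists_analyticAt_inverse hw hw0 hwd.ne'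
  have hke : AnalyticAt ℝ (fun t => k (e t)) 0 := by
    refine AnalyticAt.fun_comp ?_ he
    rwa [he0]
  have hke0 : 0 < k (e 0) := by rwa [he0]
  have hroot : AnalyticAt ℝ (fun t => k (e t) ^ ((2 * n : ℕ) : ℝ)⁻¹) 0 :=
    analyticAt_rpow_const hke hke0 _
  -- The value required of `w (σ t)`; the minus sign, lost in the even power, selects the solution
  -- on the other side of `0`.
  let y : ℝ → ℝ := fun t => -(w t) * k (e t) ^ ((2 * n : ℕ) : ℝ)⁻¹
  have hy : AnalyticAt ℝ y 0 := hw.neg.mul hroot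
  have hy0 : y 0 = 0 := by simp [y, hw0]
  have hyt : Tendsto y (𝓝 0) (𝓝 0) := by simpa [hy0] using hy.continuousAt.tendsto
  have hσ : AnalyticAt ℝ (fun t => v (y t)) 0 := by
    refine AnalyticAt.fun_comp ?_ hy
    rwa [hy0]
  have hσ0 : v (y 0) = 0 := by rw [hy0, hv0]
  have hσt : Tendsto (fun t => v (y t)) (𝓝 0) (𝓝 0) := by
    simpa [hσ0] using hσ.continuousAt.tendsto
  have het : Tendsto e (𝓝 0) (𝓝 0) := by simpa [he0] using he.continuousAt.tendsto
  have hkpos : ∀ᶠ t in 𝓝 0, 0 < k (e t) := hke.continuousAt.eventually (lt_mem_nhds hke0)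
  refine ⟨fun t => v (y t), hσ, hσ0, ?_, ?_⟩
  · obtain ⟨κ, hκ, hmono⟩ := exists_strictMonoOn hw hwd
    obtain ⟨κ', hκ', hmono'⟩ := exists_strictMonoOn hv (by rw [hvd]; positivity)
    have hI : ∀ᶠ t in 𝓝 (0 : ℝ), t ∈ Ioo (-κ) κ := Ioo_mem_nhds (by linarith) hκ
    have hI' : ∀ᶠ t in 𝓝 (0 : ℝ), t ∈ Ioo (-κ') κ' := Ioo_mem_nhds (by linarith) hκ'
    filter_upwards [hI, hyt.eventually hI', hkpos] with t h1 h2 h3 ht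
    have hwt : 0 < w t := by
      have := hmono ⟨by linarith, hκ⟩ h1 ht
      rwa [hw0] at this
    have hyneg : y t < 0 := by
      simp only [y]
      have := mul_pos hwt (Real.rpow_pos_of_pos h3 ((2 * n : ℕ) : ℝ)⁻¹)
      linarith
    have := hmono' h2 ⟨by linarith, hκ'⟩ hyneg
    rwa [hv0] at this
  · filter_upwards [hew, hσt.eventually hew, hyt.eventually hwv, hkpos, het.eventually hqk]
      with t h1 h2 h3 h4 h5
    rw [h2, h3, h5, h1]
    simp only [y]
    rw [mul_pow, Real.rpow_inv_natCast_pow h4.le (by omega), Even.neg_pow (even_two_mul n), h1]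
    ring

end OneVariable

/-! ### The flow from the vertical section and its orientation -/

section Transversal

/-- The matrix is upper triangular with first diagonal entry `1`. -/
theorem det_eq_of_apply_fst {A : ℝ × ℝ →L[ℝ] ℝ × ℝ} {a : ℝ} (ha : a ≠ 0)
    (hA : A (a, 0) = (a, 0)) : A.det = (A (0, 1)).2 := by
  have h1 : A (1, 0) = (1, 0) := by
    have : ((1 : ℝ), (0 : ℝ)) = a⁻¹ • (a, (0 : ℝ)) := by simp [ha]
    rw [this, map_smul, hA]
  have h2 : A.det = LinearMap.det (A : ℝ × ℝ →ₗ[ℝ] ℝ × ℝ) := rfl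
  rw [h2, ← LinearMap.det_toMatrix (Module.Basis.finTwoProd ℝ), Matrix.det_fin_two]
  simp [LinearMap.toMatrix_apply, h1]

/-- `Θ (t, h)` is the position at time `t` of the solution of `f` in `U` with initial condition
`(0, h)`; it is defined and analytic for `t` in `(-ε, T + ε)` and `|h| < δ`, and the solution
through the origin is `γ`. -/
structure IsTransversalFlow (f : ℝ × ℝ → ℝ × ℝ) (U : Set (ℝ × ℝ)) (γ : ℝ → ℝ × ℝ) (T ε δ : ℝ)
    (Θ : ℝ × ℝ → ℝ × ℝ) : Prop where
  analyticAt : ∀ t ∈ Ioo (-ε) (T + ε), ∀ h ∈ Ioo (-δ) δ, AnalyticAt ℝ Θ (t, h)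
  mem : ∀ t ∈ Ioo (-ε) (T + ε), ∀ h ∈ Ioo (-δ) δ, Θ (t, h) ∈ U
  hasDerivAt : ∀ t ∈ Ioo (-ε) (T + ε), ∀ h ∈ Ioo (-δ) δ,
    HasDerivAt (fun t => Θ (t, h)) (f (Θ (t, h))) t
  init : ∀ h ∈ Ioo (-δ) δ, Θ (0, h) = (0, h)
  eq_orbit : ∀ t ∈ Ioo (-ε) (T + ε), Θ (t, 0) = γ t
  deriv_pos : 0 < deriv (fun h => (Θ (T, h)).2) 0

/-- The flow is restricted to initial points on `x = 0`. The time-`T` map has positive determinant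
and its derivative fixes the velocity `(a, 0)`, so the positive quantity left over is the derivative
of the second coordinate in `h`. -/
theorem exists_isTransversalFlow {f : ℝ × ℝ → ℝ × ℝ} {U : Set (ℝ × ℝ)} (hU : IsOpen U)
    (hf : AnalyticOnNhd ℝ f U) {γ : ℝ → ℝ × ℝ} (hγ : IsIntegralCurve γ (fun _ => f))
    (hγU : ∀ t, γ t ∈ U) {T : ℝ} (hT : 0 < T) (hγ0 : γ 0 = (0, 0)) (hγT : γ T = (0, 0))
    {a : ℝ} (ha : a ≠ 0) (hf0 : f (0, 0) = (a, 0)) :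
    ∃ ε > 0, ∃ δ > 0, ∃ Θ : ℝ × ℝ → ℝ × ℝ, IsTransversalFlow f U γ T ε δ Θ := by
  obtain ⟨ε, hε, δ, hδ, Φ, hΦ⟩ := exists_isAnalyticFlow hU hf hγ hγU T
  rw [hγ0] at hΦ
  have hmem : ∀ h ∈ Ioo (-δ) δ, ((0 : ℝ), h) ∈ ball ((0 : ℝ), (0 : ℝ)) δ := by
    intro h hh
    rw [← ball_prod_same]
    refine ⟨mem_ball_self hδ, ?_⟩
    rwa [Real.ball_eq_Ioo, zero_sub, zero_add]
  have h0 : ((0 : ℝ), (0 : ℝ)) ∈ ball ((0 : ℝ), (0 : ℝ)) δ := mem_ball_self hδ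
  have hshift : ∀ s, HasDerivAt (fun t => γ (t + s)) (f (γ (0 + s))) 0 := fun s =>
    (hγ (0 + s)).comp_add_const 0 s
  refine ⟨ε, hε, δ, hδ, fun z => Φ (z.1, (0, z.2)), ⟨?_, ?_, ?_, ?_, ?_, ?_⟩⟩
  · intro t ht h hh
    exact (hΦ.isFlowAt (t, (0, h)) ⟨ht, hmem h hh⟩).analyticAt.fun_comp
      (f := fun z : ℝ × ℝ => (z.1, ((0 : ℝ), z.2))) (x := (t, h))
      (analyticAt_fst.prod (analyticAt_const.prod analyticAt_snd))
  · exact fun t ht h hh => (hΦ.isFlowAt (t, (0, h)) ⟨ht, hmem h hh⟩).mem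
  · exact fun t ht h hh => (hΦ.isFlowAt (t, (0, h)) ⟨ht, hmem h hh⟩).hasDerivAt
  · exact fun h hh => hΦ.init _ (hmem h hh)
  · refine eqOn_of_isIntegralCurveOn hf ordConnected_Ioo (hΦ.isIntegralCurveOn h0)
      (hγ.isIntegralCurveOn _) (fun t ht => (hΦ.isFlowAt (t, (0, 0)) ⟨ht, h0⟩).mem)
      (fun t _ => hγU t) (t₀ := 0) ⟨by linarith, by linarith⟩ ?_
    simp only
    rw [hΦ.init _ h0, hγ0]
  · have hTI : T ∈ Ioo (-ε) (T + ε) := ⟨by linarith, by linarith⟩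
    have hflow := hΦ.isFlowAt (T, (0, 0)) ⟨hTI, h0⟩
    have hsec : AnalyticAt ℝ (fun x => Φ (T, x)) (0, 0) :=
      hflow.analyticAt.fun_comp (f := fun x : ℝ × ℝ => (T, x)) (analyticAt_const.prod analyticAt_id)
    set A := fderiv ℝ (fun x => Φ (T, x)) (0, 0) with hA
    have hAd : HasFDerivAt (fun x => Φ (T, x)) A (0, 0) := hsec.differentiableAt.hasFDerivAt
    -- Differentiate `Φ (T, γ s) = γ (s + T)` at `s = 0`, where both `γ 0` and `γ T` are the origin.
    have hAa : A (a, 0) = (a, 0) := by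
      have h1 : HasDerivAt (fun s => Φ (T, γ s)) (A (a, 0)) 0 := by
        have h2 := hγ 0
        simp only [hγ0, hf0] at h2
        have h3 : HasFDerivAt (fun x => Φ (T, x)) A (γ 0) := by rwa [hγ0]
        exact h3.comp_hasDerivAt (f := γ) 0 h2
      have h3 : HasDerivAt (fun s => γ (s + T)) (a, 0) 0 := by
        have := hshift T
        rwa [zero_add, hγT, hf0] at this
      refine (h1.congr_of_eventuallyEq ?_).unique h3
      have hev : ∀ᶠ s in 𝓝 (0 : ℝ), γ s ∈ ball ((0 : ℝ), (0 : ℝ)) δ := by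
        refine hγ.continuous.continuousAt.eventually ?_
        rw [hγ0]
        exact ball_mem_nhds _ hδ
      filter_upwards [hev] with s hs
      have heq := eqOn_of_isIntegralCurveOn hf (ordConnected_Ioo (a := -ε) (b := T + ε))
        (hΦ.isIntegralCurveOn hs) (ψ := fun t => γ (t + s))
        (fun t _ => ((hγ (t + s)).comp_add_const t s).hasDerivWithinAt)
        (fun t ht => (hΦ.isFlowAt (t, γ s) ⟨ht, hs⟩).mem) (fun t _ => hγU _) (t₀ := 0)
        ⟨by linarith, by linarith⟩ ((hΦ.init _ hs).trans (by rw [zero_add]))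
      have : Φ (T, γ s) = γ (T + s) := heq hTI
      rw [this, add_comm]
    have hdet : 0 < (fderiv ℝ (fun x => Φ (T, x)) (0, 0)).det := hflow.det_pos
    rw [← hA, det_eq_of_apply_fst ha hAa] at hdet
    have hd : HasDerivAt (fun h : ℝ => ((0 : ℝ), h)) ((0 : ℝ), (1 : ℝ)) 0 :=
      (hasDerivAt_const 0 0).prodMk (hasDerivAt_id 0)
    have h4 : HasDerivAt (fun h : ℝ => Φ (T, ((0 : ℝ), h))) (A (0, 1)) 0 :=
      HasFDerivAt.comp_hasDerivAt (f := fun h : ℝ => ((0 : ℝ), h)) 0 hAd hd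
    have h5 : HasDerivAt (fun h : ℝ => (Φ (T, ((0 : ℝ), h))).2) (A (0, 1)).2 0 :=
      h4.snd
    exact h5.deriv ▸ hdet

end Transversal

/-! ### Levels of the axis and the return to the section -/

section LocalGeometry

variable {f : ℝ × ℝ → ℝ × ℝ} {U : Set (ℝ × ℝ)} {γ : ℝ → ℝ × ℝ} {T ε δ : ℝ} {Θ : ℝ × ℝ → ℝ × ℝ}
  {a : ℝ}

theorem IsTransversalFlow.analyticAt_zero (hΘ : IsTransversalFlow f U γ T ε δ Θ) (hT : 0 < T)
    (hε : 0 < ε) (hδ : 0 < δ) : AnalyticAt ℝ Θ (0, 0) :=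
  hΘ.analyticAt 0 ⟨by linarith, by linarith⟩ 0 ⟨by linarith, hδ⟩

/-- The columns are the velocity at the origin and the derivative of `h ↦ (0, h)`. Strictness is
what allows two nearby points to be compared in `exists_level`; for `a ≠ 0`, `Θ` is a local chart.
-/
theorem IsTransversalFlow.hasStrictFDerivAt_zero (hΘ : IsTransversalFlow f U γ T ε δ Θ)
    (hT : 0 < T) (hε : 0 < ε) (hδ : 0 < δ) (hf0 : f (0, 0) = (a, 0)) :
    HasStrictFDerivAt Θ ((a • ContinuousLinearMap.id ℝ ℝ).prodMap (ContinuousLinearMap.id ℝ ℝ))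
      (0, 0) := by
  have h := (hΘ.analyticAt_zero hT hε hδ).hasStrictFDerivAt
  set A := fderiv ℝ Θ (0, 0)
  have hΘ0 : Θ (0, 0) = (0, 0) := hΘ.init 0 ⟨by linarith, hδ⟩
  have h1 : A (1, 0) = (a, 0) := by
    have h2 : HasDerivAt (fun t : ℝ => Θ (t, (0 : ℝ))) (A (1, 0)) 0 :=
      h.hasFDerivAt.comp_hasDerivAt (f := fun t : ℝ => (t, (0 : ℝ))) 0
        ((hasDerivAt_id 0).prodMk (hasDerivAt_const 0 0))
    have h3 := hΘ.hasDerivAt 0 ⟨by linarith, by linarith⟩ 0 ⟨by linarith, hδ⟩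
    rw [hΘ0, hf0] at h3
    exact h2.unique h3
  have h2 : A (0, 1) = (0, 1) := by
    have h2 : HasDerivAt (fun t : ℝ => Θ ((0 : ℝ), t)) (A (0, 1)) 0 :=
      h.hasFDerivAt.comp_hasDerivAt (f := fun t : ℝ => ((0 : ℝ), t)) 0
        ((hasDerivAt_const 0 0).prodMk (hasDerivAt_id 0))
    have h3 : HasDerivAt (fun t : ℝ => ((0 : ℝ), t)) ((0 : ℝ), (1 : ℝ)) 0 :=
      (hasDerivAt_const 0 0).prodMk (hasDerivAt_id 0)
    refine (h2.congr_of_eventuallyEq ?_).unique h3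
    filter_upwards [Ioo_mem_nhds (show -δ < 0 by linarith) hδ] with t ht
    exact (hΘ.init t ht).symm
  have h3 : A = (a • ContinuousLinearMap.id ℝ ℝ).prodMap (ContinuousLinearMap.id ℝ ℝ) := by
    refine ContinuousLinearMap.ext fun x => ?_
    have : x = x.1 • ((1 : ℝ), (0 : ℝ)) + x.2 • ((0 : ℝ), (1 : ℝ)) := by
      ext <;> simp
    conv_lhs => rw [this]
    rw [map_add, map_smul, map_smul, h1, h2]
    ext <;> simp [mul_comm]
  rwa [h3] at h

/-- The level `e t` of the solution that meets the horizontal axis at time `t`, and the comparison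
of the second coordinate with `h - e t`. -/
theorem IsTransversalFlow.exists_level (hΘ : IsTransversalFlow f U γ T ε δ Θ)
    (hT : 0 < T) (hε : 0 < ε) (hδ : 0 < δ) (hf0 : f (0, 0) = (a, 0)) :
    ∃ e : ℝ → ℝ, AnalyticAt ℝ e 0 ∧ e 0 = 0 ∧
      ∀ᶠ z : ℝ × ℝ in 𝓝 (0, 0), |(Θ z).2 - (z.2 - e z.1)| ≤ 2⁻¹ * |z.2 - e z.1| := by
  have hΘa := hΘ.analyticAt_zero hT hε hδ
  have hΘ0 : Θ (0, 0) = (0, 0) := hΘ.init 0 ⟨by linarith, hδ⟩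
  have hF : AnalyticAt ℝ (fun z => (Θ z).2) (0, 0) :=
    (ContinuousLinearMap.snd ℝ ℝ ℝ).analyticAt _ |>.fun_comp hΘa
  have hFs : HasStrictFDerivAt (fun z => (Θ z).2) (ContinuousLinearMap.snd ℝ ℝ ℝ)
      ((0 : ℝ), (0 : ℝ)) := by
    have := (hΘ.hasStrictFDerivAt_zero hT hε hδ hf0).snd
    refine this.congr_fderiv ?_
    ext <;> simp
  have hc : ContDiffAt ℝ ω (fun z => (Θ z).2) ((0 : ℝ), (0 : ℝ)) := hF.contDiffAt
  have hinv : (fderiv ℝ (fun z => (Θ z).2) ((0 : ℝ), (0 : ℝ)) ∘L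
      ContinuousLinearMap.inr ℝ ℝ ℝ).IsInvertible := by
    rw [hFs.hasFDerivAt.fderiv]
    exact ⟨ContinuousLinearEquiv.refl ℝ ℝ, by ext; simp⟩
  let e : ℝ → ℝ := hc.implicitFunction (by simp) hinv
  have hea : AnalyticAt ℝ e 0 := (hc.contDiffAt_implicitFunction (by simp) hinv).analyticAt
  have he0 : e 0 = 0 := hc.implicitFunction_apply_self (by simp) hinv
  have hez : ∀ᶠ t in 𝓝 (0 : ℝ), (Θ (t, e t)).2 = 0 := by
    have := hc.eventually_apply_implicitFunction (by simp) hinv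
    rw [hΘ0] at this
    exact this
  refine ⟨e, hea, he0, ?_⟩
  -- Strict differentiability is applied to `(t, h)` and `(t, e t)`: they differ only in `h`, the
  -- second coordinate of `Θ` vanishes at the latter, and the derivative is the second projection.
  have hlim : Tendsto (fun z : ℝ × ℝ => (z, (z.1, e z.1))) (𝓝 (0, 0)) (𝓝 ((0, 0), (0, 0))) := by
    have h1 : ContinuousAt (fun z : ℝ × ℝ => e z.1) (0, 0) :=
      ContinuousAt.comp (f := fun z : ℝ × ℝ => z.1) (x := (0, 0)) hea.continuousAt
        continuousAt_fst
    have h2 : ContinuousAt (fun z : ℝ × ℝ => (z, (z.1, e z.1))) (0, 0) :=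
      continuousAt_id.prodMk (continuousAt_fst.prodMk h1)
    simpa [ContinuousAt, he0] using h2
  have hlo := hFs.isLittleO.bound (show (0 : ℝ) < 2⁻¹ by norm_num)
  filter_upwards [hlim.eventually hlo, (continuous_fst.tendsto ((0 : ℝ), (0 : ℝ))).eventually hez]
    with z h1 h2
  simp only [h2, sub_zero, ContinuousLinearMap.coe_snd', Prod.snd_sub, Real.norm_eq_abs] at h1
  refine h1.trans_eq ?_
  congr 1
  have : z - (z.1, e z.1) = (0, z.2 - e z.1) := by ext <;> simp
  rw [this, Prod.norm_def]
  simp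

/-- The flow returns after the time `T` near the origin, on the solution through `(0, q h)` and
with the time shift `ρ h`. -/
theorem IsTransversalFlow.exists_return (hf : AnalyticOnNhd ℝ f U)
    (hΘ : IsTransversalFlow f U γ T ε δ Θ)
    (hT : 0 < T) (hε : 0 < ε) (hδ : 0 < δ) (hf0 : f (0, 0) = (a, 0)) (ha : a ≠ 0)
    (hγT : γ T = (0, 0)) :
    ∃ ρ q : ℝ → ℝ, AnalyticAt ℝ ρ 0 ∧ AnalyticAt ℝ q 0 ∧ ρ 0 = 0 ∧ q 0 = 0 ∧ 0 < deriv q 0 ∧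
      ∃ κ > 0, ∀ h ∈ Ioo (-κ) κ, ∀ s ∈ Ioo (-κ) κ, Θ (T + s, h) = Θ (s + ρ h, q h) := by
  have hΘa := hΘ.analyticAt_zero hT hε hδ
  have hΘ0 : Θ (0, 0) = (0, 0) := hΘ.init 0 ⟨by linarith, hδ⟩
  have hΘT : Θ (T, 0) = (0, 0) := by rw [hΘ.eq_orbit T ⟨by linarith, by linarith⟩, hγT]
  have hΘs := hΘ.hasStrictFDerivAt_zero hT hε hδ hf0
  let A : (ℝ × ℝ) ≃L[ℝ] ℝ × ℝ :=
    (ContinuousLinearEquiv.unitsEquivAut ℝ (Units.mk0 a ha)).prodCongr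
      (ContinuousLinearEquiv.refl ℝ ℝ)
  have hA : ((a • ContinuousLinearMap.id ℝ ℝ).prodMap (ContinuousLinearMap.id ℝ ℝ)
      : ℝ × ℝ →L[ℝ] ℝ × ℝ) = A := by
    ext <;> simp [A]
  rw [hA] at hΘs
  have hc : ContDiffAt ℝ ω Θ ((0 : ℝ), (0 : ℝ)) := hΘa.contDiffAt
  -- `χ` reads a point near the origin in the chart `(t, h)`; `ρ h` and `q h` are the coordinates of
  -- `Θ (T, h)`.
  let χ := hc.localInverse hΘs.hasFDerivAt (by simp)
  have hχa : AnalyticAt ℝ χ (0, 0) := by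
    have := (hc.to_localInverse hΘs.hasFDerivAt (by simp)).analyticAt
    rwa [hΘ0] at this
  have hχ0 : χ (0, 0) = (0, 0) := by
    have := hc.localInverse_apply_image hΘs.hasFDerivAt (by simp)
    rwa [hΘ0] at this
  have hχr : ∀ᶠ y in 𝓝 ((0 : ℝ), (0 : ℝ)), Θ (χ y) = y := by
    have := (hc.hasStrictFDerivAt' hΘs.hasFDerivAt (by simp)).eventually_right_inverse
    rwa [hΘ0] at this
  have hret : AnalyticAt ℝ (fun h : ℝ => Θ (T, h)) 0 :=
    (hΘ.analyticAt T ⟨by linarith, by linarith⟩ 0 ⟨by linarith, hδ⟩).fun_comp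
      (f := fun h : ℝ => (T, h)) (analyticAt_const.prod analyticAt_id)
  have hχh : AnalyticAt ℝ (fun h : ℝ => χ (Θ (T, h))) 0 := by
    refine AnalyticAt.fun_comp ?_ hret
    rwa [hΘT]
  have hρ : AnalyticAt ℝ (fun h : ℝ => (χ (Θ (T, h))).1) 0 :=
    (ContinuousLinearMap.fst ℝ ℝ ℝ).analyticAt _ |>.fun_comp hχh
  have hq : AnalyticAt ℝ (fun h : ℝ => (χ (Θ (T, h))).2) 0 :=
    (ContinuousLinearMap.snd ℝ ℝ ℝ).analyticAt _ |>.fun_comp hχh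
  have hρ0 : (χ (Θ (T, 0))).1 = 0 := by rw [hΘT, hχ0]
  have hq0 : (χ (Θ (T, 0))).2 = 0 := by rw [hΘT, hχ0]
  have hev : ∀ᶠ h in 𝓝 (0 : ℝ), Θ (χ (Θ (T, h))) = Θ (T, h) := by
    have h1 := hret.continuousAt.tendsto
    rw [hΘT] at h1
    exact h1.eventually hχr
  refine ⟨_, _, hρ, hq, hρ0, hq0, ?_, ?_⟩
  -- The linear part of the chart leaves the second coordinate unchanged, so `q' 0` is the
  -- derivative in `deriv_pos`.
  · have h1 : HasDerivAt (fun h : ℝ => Θ (χ (Θ (T, h))))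
        ((A : ℝ × ℝ →L[ℝ] ℝ × ℝ) (deriv (fun h : ℝ => χ (Θ (T, h))) 0)) 0 := by
      have h2 : HasFDerivAt Θ (A : ℝ × ℝ →L[ℝ] ℝ × ℝ) (χ (Θ (T, 0))) := by
        rw [hΘT, hχ0]; exact hΘs.hasFDerivAt
      exact h2.comp_hasDerivAt (f := fun h : ℝ => χ (Θ (T, h))) 0
        hχh.differentiableAt.hasDerivAt
    have h2 : HasDerivAt (fun h : ℝ => (Θ (T, h)).2)
        (deriv (fun h : ℝ => χ (Θ (T, h))) 0).2 0 := by
      have h3 : ∀ x : ℝ × ℝ, ((A : ℝ × ℝ →L[ℝ] ℝ × ℝ) x).2 = x.2 := fun x => by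
        rw [← hA]; simp
      rw [← h3]
      exact (h1.congr_of_eventuallyEq (hev.mono fun _ h => h.symm)).snd
    have h3 : HasDerivAt (fun h : ℝ => (χ (Θ (T, h))).2)
        (deriv (fun h : ℝ => χ (Θ (T, h))) 0).2 0 := hχh.differentiableAt.hasDerivAt.snd
    rw [h3.deriv, ← h2.deriv]
    exact hΘ.deriv_pos
  · have hρc : ∀ᶠ h in 𝓝 (0 : ℝ), (χ (Θ (T, h))).1 ∈ Ioo (-(ε / 2)) (ε / 2) := by
      refine hρ.continuousAt.eventually ?_
      simp only [hρ0]
      exact Ioo_mem_nhds (by linarith) (by linarith)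
    have hqc : ∀ᶠ h in 𝓝 (0 : ℝ), (χ (Θ (T, h))).2 ∈ Ioo (-δ) δ := by
      refine hq.continuousAt.eventually ?_
      simp only [hq0]
      exact Ioo_mem_nhds (by linarith) (by linarith)
    obtain ⟨κ, hκ, hκb⟩ := Metric.eventually_nhds_iff_ball.1 (hev.and (hρc.and hqc))
    rw [Real.ball_eq_Ioo, zero_sub, zero_add] at hκb
    refine ⟨min (min κ δ) (min (ε / 2) T), by positivity, fun h hh s hs => ?_⟩
    set μ := min (min κ δ) (min (ε / 2) T)
    have hμ1 : μ ≤ κ := (min_le_left _ _).trans (min_le_left _ _)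
    have hμ2 : μ ≤ δ := (min_le_left _ _).trans (min_le_right _ _)
    have hμ3 : μ ≤ ε / 2 := (min_le_right _ _).trans (min_le_left _ _)
    have hμ4 : μ ≤ T := (min_le_right _ _).trans (min_le_right _ _)
    have hμ0 : 0 < μ := by positivity
    obtain ⟨e1, e2, e3⟩ := hκb h ⟨by linarith [hh.1], by linarith [hh.2]⟩
    have hh' : h ∈ Ioo (-δ) δ := ⟨by linarith [hh.1], by linarith [hh.2]⟩
    have m1 : ∀ s ∈ Ioo (-μ) μ, T + s ∈ Ioo (-ε) (T + ε) := fun s hs =>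
      ⟨by linarith [hs.1], by linarith [hs.2]⟩
    have m2 : ∀ s ∈ Ioo (-μ) μ, s + (χ (Θ (T, h))).1 ∈ Ioo (-ε) (T + ε) := fun s hs =>
      ⟨by linarith [hs.1, e2.1], by linarith [hs.2, e2.2]⟩
    -- Both sides solve the autonomous system in `s` and agree at `s = 0` by the choice of `ρ` and
    -- `q`.
    refine eqOn_of_isIntegralCurveOn hf (ordConnected_Ioo (a := -μ) (b := μ))
      (φ := fun s => Θ (T + s, h)) (ψ := fun s => Θ (s + (χ (Θ (T, h))).1, (χ (Θ (T, h))).2))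
      (fun s hs => ?_) (fun s hs => ?_) (fun s hs => hΘ.mem _ (m1 s hs) h hh')
      (fun s hs => hΘ.mem _ (m2 s hs) _ e3) (t₀ := 0) ⟨by linarith, hμ0⟩ ?_ hs
    · exact ((hΘ.hasDerivAt _ (m1 s hs) h hh').comp_const_add T s).hasDerivWithinAt
    · exact ((hΘ.hasDerivAt _ (m2 s hs) _ e3).comp_add_const s _).hasDerivWithinAt
    · simp only [add_zero, zero_add]
      exact e1.symm

end LocalGeometry

/-! ### Construction of the arc returning to the axis -/

section Return

/-- `ψ` is an arc of a solution of `f` in `U` that leaves `(x, 0)` upwards, coming from below, and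
meets the horizontal axis again for the first time at the time `b`, in `(y, 0)`. -/
structure IsUpperArc (f : ℝ × ℝ → ℝ × ℝ) (U : Set (ℝ × ℝ)) (x b y : ℝ) (ψ : ℝ → ℝ × ℝ)
    (t₀ t₁ : ℝ) : Prop where
  neg : t₀ < 0
  time_pos : 0 < b
  lt : b < t₁
  isIntegralCurveOn : IsIntegralCurveOn ψ (fun _ => f) (Ioo t₀ t₁)
  mapsTo : MapsTo ψ (Ioo t₀ t₁) U
  start : ψ 0 = (x, 0)
  finish : ψ b = (y, 0)
  above : ∀ t ∈ Ioo 0 b, 0 < (ψ t).2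
  below : ∀ t ∈ Ioo t₀ 0, (ψ t).2 < 0

theorem exists_box {p : ℝ → ℝ → Prop} (h : ∀ᶠ z : ℝ × ℝ in 𝓝 (0, 0), p z.1 z.2) :
    ∃ κ > 0, ∀ s ∈ Ioo (-κ) κ, ∀ t ∈ Ioo (-κ) κ, p s t := by
  obtain ⟨κ, hκ, hb⟩ := Metric.eventually_nhds_iff_ball.1 h
  refine ⟨κ, hκ, fun s hs t ht => hb (s, t) ?_⟩
  rw [← ball_prod_same]
  constructor <;> rwa [Real.ball_eq_Ioo, zero_sub, zero_add]

theorem exists_interval {p : ℝ → Prop} (h : ∀ᶠ z : ℝ in 𝓝 0, p z) :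
    ∃ κ > 0, ∀ s ∈ Ioo (-κ) κ, p s := by
  obtain ⟨κ, hκ, hb⟩ := Metric.eventually_nhds_iff_ball.1 h
  rw [Real.ball_eq_Ioo, zero_sub, zero_add] at hb
  exact ⟨κ, hκ, hb⟩

theorem eventually_mem_Ioo {g : ℝ → ℝ} (hg : ContinuousAt g 0) (h0 : g 0 = 0) {κ : ℝ}
    (hκ : 0 < κ) : ∀ᶠ t in 𝓝 0, g t ∈ Ioo (-κ) κ := by
  refine hg.eventually ?_
  rw [h0]
  exact Ioo_mem_nhds (by linarith) hκ

variable {f : ℝ × ℝ → ℝ × ℝ} {U : Set (ℝ × ℝ)} {γ : ℝ → ℝ × ℝ} {T ε δ : ℝ} {Θ : ℝ × ℝ → ℝ × ℝ}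
  {a : ℝ}

/-- Away from its endpoints the orbit is strictly above the axis, and compactness of the time
interval makes this stable in `h`. -/
theorem IsTransversalFlow.eventually_pos (hΘ : IsTransversalFlow f U γ T ε δ Θ) (hε : 0 < ε)
    (hδ : 0 < δ) (hγpos : ∀ t ∈ Ioo 0 T, 0 < (γ t).2) {κ : ℝ} (hκ : 0 < κ) :
    ∀ᶠ h in 𝓝 (0 : ℝ), ∀ s ∈ Icc κ (T - κ), 0 < (Θ (s, h)).2 := by
  refine isCompact_Icc.eventually_forall_of_forall_eventually fun s hs => ?_
  have hsI : s ∈ Ioo (-ε) (T + ε) := ⟨by linarith [hs.1], by linarith [hs.2]⟩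
  have h1 : ContinuousAt (fun z : ℝ × ℝ => (Θ (z.2, z.1)).2) (0, s) := by
    have h2 : ContinuousAt (fun z : ℝ × ℝ => Θ (z.2, z.1)) (0, s) :=
      ContinuousAt.comp (f := fun z : ℝ × ℝ => (z.2, z.1)) (x := (0, s))
        (hΘ.analyticAt s hsI 0 ⟨by linarith, hδ⟩).continuousAt
        (continuousAt_snd.prodMk continuousAt_fst)
    exact h2.snd
  refine h1.eventually (lt_mem_nhds ?_)
  simp only
  rw [hΘ.eq_orbit s hsI]
  exact hγpos s ⟨by linarith [hs.1], by linarith [hs.2]⟩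

/-- The point `(x, 0)` is met at section time `b x` on level `e (b x)`. After the shift by `T` that
solution runs on level `q (e (b x))` and reaches the axis at section time `s (b x) < 0`. No crossing
happens in between because `e` is strictly monotone on each side of `0`. -/
theorem IsTransversalFlow.exists_upperArc (hf : AnalyticOnNhd ℝ f U)
    (hΘ : IsTransversalFlow f U γ T ε δ Θ) (hT : 0 < T) (hε : 0 < ε) (hδ : 0 < δ)
    (hf0 : f (0, 0) = (a, 0)) (ha : 0 < a) (hγT : γ T = (0, 0)) {n : ℕ} (hn : 1 ≤ n)
    (hord : analyticOrderAt (fun t => (γ t).2) 0 = (2 * n : ℕ))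
    (hγpos : ∀ t ∈ Ioo 0 T, 0 < (γ t).2) (hγnonneg : ∀ t, 0 ≤ (γ t).2) :
    ∃ A B : ℝ → ℝ, AnalyticAt ℝ A 0 ∧ AnalyticAt ℝ B 0 ∧ A 0 = 0 ∧ B 0 = T ∧
      ∀ᶠ x in 𝓝 0, 0 < x → A x < 0 ∧ ∃ ψ t₀ t₁, IsUpperArc f U x (B x) (A x) ψ t₀ t₁ := by
  have hΘa := hΘ.analyticAt_zero hT hε hδ
  have hΘ0 : Θ (0, 0) = (0, 0) := hΘ.init 0 ⟨by linarith, hδ⟩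
  obtain ⟨e, hea, he0, hlev⟩ := hΘ.exists_level hT hε hδ hf0
  obtain ⟨ρ, q, hρ, hq, hρ0, hq0, hqd, κ₀, hκ₀, hret⟩ :=
    hΘ.exists_return hf hT hε hδ hf0 ha.ne' hγT
  obtain ⟨w, hw, hw0, hwd, hew⟩ := exists_analyticAt_root hn hord hea
    (Eventually.of_forall hγnonneg) (by
      have hlim : Tendsto (fun t : ℝ => (t, (0 : ℝ))) (𝓝 0) (𝓝 (0, 0)) :=
        (Continuous.prodMk_left (0 : ℝ)).tendsto 0
      filter_upwards [hlim.eventually hlev,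
        Ioo_mem_nhds (show -ε < 0 by linarith) (show 0 < T + ε by linarith)] with t ht ht'
      simpa [hΘ.eq_orbit t ht'] using ht)
  obtain ⟨s, hs, hs0, hsneg, hse⟩ := exists_analyticAt_involution hn hw hw0 hwd hea hew hq hq0 hqd
  obtain ⟨κ₁, hκ₁, hmono⟩ := exists_strictMonoOn hw hwd
  obtain ⟨κ₂, hκ₂, hlev⟩ := exists_box (p := fun t h => |(Θ (t, h)).2 - (h - e t)| ≤
    2⁻¹ * |h - e t|) hlev
  obtain ⟨κ₃, hκ₃, hew⟩ := exists_interval hew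
  obtain ⟨κ, hκ, l0, l1, l2, l3, l4, l5, l6⟩ : ∃ κ > 0, κ ≤ κ₀ ∧ κ ≤ κ₁ ∧ κ ≤ κ₂ ∧ κ ≤ κ₃ ∧
      κ ≤ ε ∧ κ ≤ δ ∧ κ ≤ T / 2 := by
    refine ⟨min (min (min κ₀ κ₁) (min κ₂ κ₃)) (min (min ε δ) (T / 2)), by positivity, ?_⟩
    simp only [min_le_iff, le_refl, true_or, or_true, and_self]
  have hsub : ∀ {μ : ℝ}, κ ≤ μ → ∀ {t}, t ∈ Ioo (-κ) κ → t ∈ Ioo (-μ) μ := fun hμ t ht =>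
    ⟨by linarith [ht.1], by linarith [ht.2]⟩
  have habove : ∀ t ∈ Ioo (-κ) κ, ∀ h ∈ Ioo (-κ) κ, e t < h → 0 < (Θ (t, h)).2 := by
    intro t ht h hh hlt
    have := hlev t (hsub l2 ht) h (hsub l2 hh)
    rw [abs_of_pos (sub_pos.2 hlt)] at this
    linarith [(abs_le.1 this).1]
  have hbelow : ∀ t ∈ Ioo (-κ) κ, ∀ h ∈ Ioo (-κ) κ, h < e t → (Θ (t, h)).2 < 0 := by
    intro t ht h hh hlt
    have := hlev t (hsub l2 ht) h (hsub l2 hh)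
    rw [abs_of_neg (sub_neg.2 hlt)] at this
    linarith [(abs_le.1 this).2]
  have hon : ∀ t ∈ Ioo (-κ) κ, e t ∈ Ioo (-κ) κ → (Θ (t, e t)).2 = 0 := by
    intro t ht hh
    have := hlev t (hsub l2 ht) (e t) (hsub l2 hh)
    simpa using this
  have h0κ : (0 : ℝ) ∈ Ioo (-κ) κ := ⟨by linarith, hκ⟩
  have hanti : ∀ t ∈ Ioo (-κ) κ, ∀ u ∈ Ioo (-κ) κ, 0 ≤ t → t < u → e u < e t := by
    intro t ht u hu h0 htu
    rw [hew t (hsub l3 ht), hew u (hsub l3 hu), neg_lt_neg_iff]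
    have h1 : 0 ≤ w t := by
      rw [← hw0]; exact hmono.monotoneOn (hsub l1 h0κ) (hsub l1 ht) h0
    exact pow_lt_pow_left₀ (hmono (hsub l1 ht) (hsub l1 hu) htu) h1 (by omega)
  have hincr : ∀ t ∈ Ioo (-κ) κ, ∀ u ∈ Ioo (-κ) κ, t ≤ 0 → u < t → e u < e t := by
    intro t ht u hu h0 htu
    rw [hew t (hsub l3 ht), hew u (hsub l3 hu), neg_lt_neg_iff,
      ← (even_two_mul n).neg_pow (w t), ← (even_two_mul n).neg_pow (w u)]
    have h1 : w t ≤ 0 := by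
      rw [← hw0]; exact hmono.monotoneOn (hsub l1 ht) (hsub l1 h0κ) h0
    have h2 := hmono (hsub l1 hu) (hsub l1 ht) htu
    exact pow_lt_pow_left₀ (by linarith) (by linarith) (by omega)
  -- the horizontal axis, parametrized by the time
  have hxa : AnalyticAt ℝ (fun t => Θ (t, e t)) 0 := by
    refine AnalyticAt.fun_comp (f := fun t : ℝ => (t, e t)) ?_ (analyticAt_id.prod hea)
    rwa [he0]
  let ξ : ℝ → ℝ := fun t => (Θ (t, e t)).1
  have hξ : AnalyticAt ℝ ξ 0 := (ContinuousLinearMap.fst ℝ ℝ ℝ).analyticAt _ |>.fun_comp hxa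
  have hξ0 : ξ 0 = 0 := by simp [ξ, he0, hΘ0]
  have hξd : deriv ξ 0 = a := by
    have h1 := (hΘ.hasStrictFDerivAt_zero hT hε hδ hf0).hasFDerivAt
    rw [show ((0 : ℝ), (0 : ℝ)) = (0, e 0) by rw [he0]] at h1
    have h2 : HasDerivAt (fun t : ℝ => (t, e t)) (1, deriv e 0) 0 :=
      (hasDerivAt_id 0).prodMk hea.differentiableAt.hasDerivAt
    have h3 : HasDerivAt ξ (((a • ContinuousLinearMap.id ℝ ℝ).prodMap
        (ContinuousLinearMap.id ℝ ℝ)) (1, deriv e 0)).1 0 :=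
      (h1.comp_hasDerivAt (f := fun t : ℝ => (t, e t)) 0 h2).fst
    rw [h3.deriv]
    simp
  obtain ⟨b, hb, hb0, hbd, hξb, -⟩ := exists_analyticAt_inverse hξ hξ0 (by rw [hξd]; exact ha.ne')
  obtain ⟨κ₄, hκ₄, hξmono⟩ := exists_strictMonoOn hξ (by rwa [hξd])
  obtain ⟨κ₅, hκ₅, hbmono⟩ := exists_strictMonoOn hb (by rw [hbd, hξd]; positivity)
  have hes : AnalyticAt ℝ (fun t => ρ (e t)) 0 := by
    refine AnalyticAt.fun_comp ?_ hea
    rwa [he0]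
  have heq : AnalyticAt ℝ (fun t => q (e t)) 0 := by
    refine AnalyticAt.fun_comp ?_ hea
    rwa [he0]
  have hbt : Tendsto b (𝓝 0) (𝓝 0) := by simpa [hb0] using hb.continuousAt.tendsto
  have het : Tendsto e (𝓝 0) (𝓝 0) := by simpa [he0] using hea.continuousAt.tendsto
  -- The flight time runs from `b x` to the time `T + u` with `u + ρ (e (b x)) = s (b x)`.
  refine ⟨fun x => ξ (s (b x)), fun x => T - b x + s (b x) - ρ (e (b x)), ?_, ?_, ?_, ?_, ?_⟩
  · refine AnalyticAt.fun_comp ?_ (AnalyticAt.fun_comp ?_ hb)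
    · rwa [hb0, hs0]
    · rwa [hb0]
  · refine ((analyticAt_const.sub hb).add (AnalyticAt.fun_comp ?_ hb)).sub
      (AnalyticAt.fun_comp (g := fun t => ρ (e t)) ?_ hb)
    · rwa [hb0]
    · rwa [hb0]
  · simp [hb0, hs0, hξ0]
  · simp [hb0, hs0, he0, hρ0]
  -- With `b x`, `s (b x)` and `ρ (e (b x))` each below `κ / 4` in size, all combined shifts stay
  -- inside the window, and `κ ≤ T / 2` keeps the flight time positive.
  have hκ4 : 0 < κ / 4 := by linarith
  filter_upwards [hξb, hbt.eventually (hsneg.and hse),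
    hbt.eventually (eventually_mem_Ioo hs.continuousAt hs0 hκ4),
    hbt.eventually (eventually_mem_Ioo hes.continuousAt (by rw [he0, hρ0]) hκ4),
    hbt.eventually (eventually_mem_Ioo heq.continuousAt (by rw [he0, hq0]) hκ),
    hbt.eventually (eventually_mem_Ioo hea.continuousAt he0 hκ),
    hbt.eventually (eventually_mem_Ioo hs.continuousAt hs0 hκ₄),
    eventually_mem_Ioo hb.continuousAt hb0 hκ4,
    Ioo_mem_nhds (show -κ₅ < 0 by linarith) hκ₅,
    hbt.eventually (het.eventually (hΘ.eventually_pos hε hδ hγpos (half_pos hκ)))]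
    with x x1 x2 x3 x4 x5 x6 x7 x8 x9 x10 hx
  have hbx : 0 < b x := by
    have := hbmono ⟨by linarith, hκ₅⟩ x9 hx
    rwa [hb0] at this
  have hsx := x2.1 hbx
  have m1 : b x ∈ Ioo (-κ) κ := ⟨by linarith [x8.1], by linarith [x8.2]⟩
  have m2 : s (b x) ∈ Ioo (-κ) κ := ⟨by linarith [x3.1], by linarith [x3.2]⟩
  refine ⟨?_, fun t => Θ (b x + t, e (b x)), -b x, T + ε - b x, ?_⟩
  · rw [← hξ0]
    exact hξmono x7 ⟨by linarith, hκ₄⟩ hsx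
  have hdom : ∀ t ∈ Ioo (-b x) (T + ε - b x), b x + t ∈ Ioo (-ε) (T + ε) := fun t ht =>
    ⟨by linarith [ht.1], by linarith [ht.2]⟩
  refine ⟨by linarith, by linarith [x8.2, x3.1, x4.2], by linarith [x4.1], fun t ht => ?_,
    fun t ht => hΘ.mem _ (hdom t ht) _ (hsub l5 x6), ?_, ?_, ?_, ?_⟩
  · exact ((hΘ.hasDerivAt _ (hdom t ht) _ (hsub l5 x6)).comp_const_add (b x) t).hasDerivWithinAt
  · simp only [add_zero]
    exact Prod.ext x1 (hon _ m1 x6)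
  · have h1 : b x + (T - b x + s (b x) - ρ (e (b x))) = T + (s (b x) - ρ (e (b x))) := by ring
    rw [h1, hret _ (hsub l0 x6) _
      ⟨by linarith [x3.1, x4.2], by linarith [x3.2, x4.1]⟩, sub_add_cancel, ← x2.2]
    refine Prod.ext rfl (hon _ m2 ?_)
    rwa [x2.2]
  · intro t ht
    set u := b x + t
    -- Three regimes: just after departure `e` has decreased below the level; in the middle the
    -- orbit is uniformly high; near `T` the return formula applies and `e`, increasing on negative
    -- times, has not yet reached the level.
    rcases lt_or_ge u κ with h1 | h1
    · have mu : u ∈ Ioo (-κ) κ := ⟨by linarith [ht.1], h1⟩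
      exact habove u mu _ x6 (hanti _ m1 u mu hbx.le (by linarith [ht.1]))
    rcases le_or_gt u (T - κ / 2) with h2 | h2
    · exact x10 u ⟨by linarith, h2⟩
    · have h3 : u - T < s (b x) - ρ (e (b x)) := by linarith [ht.2]
      have h4 : Θ (u, e (b x)) = Θ (u - T + ρ (e (b x)), q (e (b x))) := by
        rw [← hret _ (hsub l0 x6) _ ⟨by linarith, by linarith [x3.2, x4.1]⟩, add_sub_cancel]
      have mv : u - T + ρ (e (b x)) ∈ Ioo (-κ) κ :=
        ⟨by linarith [x4.1], by linarith [x3.2]⟩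
      rw [h4]
      refine habove _ mv _ x5 ?_
      rw [← x2.2]
      exact hincr _ m2 _ mv hsx.le (by linarith)
  · intro t ht
    have mu : b x + t ∈ Ioo (-κ) κ := ⟨by linarith [ht.1], by linarith [ht.2, m1.2]⟩
    exact hbelow _ mu _ x6 (hanti _ mu _ m1 (by linarith [ht.1]) (by linarith [ht.2]))

end Return

theorem exists_hasSum_of_analyticAt {A : ℝ → ℝ} (hA : AnalyticAt ℝ A 0) :
    ∃ α : ℕ → ℝ, α 0 = A 0 ∧ ∃ r > 0, ∀ x ∈ Ioo (-r) r, HasSum (fun i => α i * x ^ i) (A x) := by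
  obtain ⟨p, hp⟩ := hA
  have hev : ∀ᶠ x in 𝓝 (0 : ℝ), HasSum (fun i => p.coeff i * x ^ i) (A x) := by
    filter_upwards [hp.eventually_hasSum_sub] with x hx
    simpa [mul_comm] using hx
  refine ⟨p.coeff, ?_, exists_interval hev⟩
  have h1 := hev.self_of_nhds
  have h2 := hasSum_single (f := fun i => p.coeff i * (0 : ℝ) ^ i) 0 fun i hi => by simp [hi]
  rw [h1.unique h2]
  simp

/-! ### Uniqueness of half-return maps and their series -/

section HalfReturnMaps

variable {P Q : ℝ × ℝ → ℝ} {U : Set (ℝ × ℝ)}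

/-- A negative flight time would put the solution above the axis where the arc is below it, and a
zero one would give `φ x = x > 0`. For a positive one, an end before `b` contradicts `above`, and an
end after `b` contradicts positivity during the flight. -/
theorem IsHalfReturn.eq_of_isUpperArc (hf : AnalyticOnNhd ℝ (fun p => (P p, Q p)) U)
    {x₀ x b y : ℝ} {τ φ : ℝ → ℝ} (h : IsHalfReturn P Q U x₀ τ φ) (hx : x ∈ Ioo 0 x₀)
    {ψ : ℝ → ℝ × ℝ} {t₀ t₁ : ℝ} (hψ : IsUpperArc (fun p => (P p, Q p)) U x b y ψ t₀ t₁) :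
    φ x = y ∧ τ x = b := by
  obtain ⟨χ, ⟨hχU, hχ⟩, hχ0, hχτ, hχpos⟩ := h.exists_solution x hx
  have hneg := h.map_neg x hx
  have hagree : ∀ s t : ℝ, s ≤ 0 → 0 ≤ t → Icc s t ⊆ Ioo t₀ t₁ → Icc s t ⊆ uIcc 0 (τ x) →
      EqOn χ ψ (Icc s t) := fun s t hs ht h1 h2 =>
    eqOn_of_isIntegralCurveOn hf ordConnected_Icc (hχ.mono h2) (hψ.isIntegralCurveOn.mono h1)
      (hχU.mono_left h2) (hψ.mapsTo.mono_left h1) (t₀ := 0) ⟨hs, ht⟩ (by rw [hχ0, hψ.start])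
  have ht₀ := hψ.neg
  have hb := hψ.time_pos
  have hb₁ := hψ.lt
  rcases lt_trichotomy (τ x) 0 with hτ | hτ | hτ
  · exfalso
    rw [uIcc_of_ge hτ.le] at hagree
    rw [uIoo_of_ge hτ.le] at hχpos
    set m := max (τ x / 2) (t₀ / 2)
    have m1 : τ x < m := lt_max_of_lt_left (by linarith)
    have m2 : t₀ < m := lt_max_of_lt_right (by linarith)
    have m3 : m < 0 := max_lt (by linarith) (by linarith)
    have h1 := hagree m 0 m3.le le_rfl (fun t ht => ⟨by linarith [ht.1], by linarith [ht.2]⟩)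
      (Icc_subset_Icc_left m1.le) ⟨le_rfl, m3.le⟩
    have h2 := hχpos m ⟨m1, m3⟩
    have h3 := hψ.below m ⟨m2, m3⟩
    rw [h1] at h2
    linarith
  · exfalso
    rw [hτ, hχ0] at hχτ
    have := congrArg Prod.fst hχτ
    simp only at this
    linarith [hx.1]
  · rw [uIcc_of_le hτ.le] at hagree
    rw [uIoo_of_le hτ.le] at hχpos
    rcases lt_trichotomy (τ x) b with h1 | h1 | h1
    · exfalso
      have h2 := hagree 0 (τ x) le_rfl hτ.le
        (fun t ht => ⟨by linarith [ht.1], by linarith [ht.2]⟩) subset_rfl (right_mem_Icc.2 hτ.le)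
      have h3 := hψ.above _ ⟨hτ, h1⟩
      rw [← h2, hχτ] at h3
      exact lt_irrefl _ h3
    · refine ⟨?_, h1⟩
      have h2 := hagree 0 (τ x) le_rfl hτ.le
        (fun t ht => ⟨by linarith [ht.1], by linarith [ht.2]⟩) subset_rfl (right_mem_Icc.2 hτ.le)
      rw [hχτ, h1, hψ.finish] at h2
      exact congrArg Prod.fst h2
    · exfalso
      have h2 := hagree 0 b le_rfl hb.le
        (fun t ht => ⟨by linarith [ht.1], by linarith [ht.2]⟩) (Icc_subset_Icc_right h1.le)
        (right_mem_Icc.2 hb.le)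
      have h3 := hχpos _ ⟨hb, h1⟩
      rw [h2, hψ.finish] at h3
      exact lt_irrefl _ h3

/-- Half-return maps of the reversed vector field are the half-return maps with opposite flight
time. -/
theorem IsHalfReturn.reverse {x₀ : ℝ} {τ φ : ℝ → ℝ} (h : IsHalfReturn P Q U x₀ τ φ) :
    IsHalfReturn (fun p => -P p) (fun p => -Q p) U x₀ (fun x => -τ x) φ := by
  refine ⟨h.pos, h.continuousOn_time.neg, h.continuousOn_map, h.map_zero, h.map_neg,
    fun x hx => ?_⟩
  obtain ⟨ψ, ⟨hψU, hψ⟩, hψ0, hψτ, hψpos⟩ := h.exists_solution x hx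
  have hmem : ∀ t ∈ uIcc 0 (-τ x), -t ∈ uIcc 0 (τ x) := by
    intro t ht
    rw [mem_uIcc] at ht ⊢
    rcases ht with ht | ht
    · exact Or.inr ⟨by linarith [ht.2], by linarith [ht.1]⟩
    · exact Or.inl ⟨by linarith [ht.2], by linarith [ht.1]⟩
  refine ⟨fun t => ψ (-t), ⟨fun t ht => hψU (hmem t ht), fun t ht => ?_⟩, by simpa using hψ0,
    by simpa using hψτ, fun t ht => hψpos _ ?_⟩
  · have := (hψ (-t) (hmem t ht)).scomp t (hasDerivAt_neg t).hasDerivWithinAt hmem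
    simpa using! this
  · rcases le_total (τ x) 0 with hτ | hτ
    · rw [uIoo_of_le (by linarith)] at ht
      rw [uIoo_of_ge hτ]
      exact ⟨by linarith [ht.2], by linarith [ht.1]⟩
    · rw [uIoo_of_ge (by linarith)] at ht
      rw [uIoo_of_le hτ]
      exact ⟨by linarith [ht.2], by linarith [ht.1]⟩

theorem exists_series_of_pos (hU : IsOpen U) (hf : AnalyticOnNhd ℝ (fun p => (P p, Q p)) U)
    {γ : ℝ → ℝ × ℝ} (hγ : IsIntegralCurve γ (fun _ p => (P p, Q p))) (hγU : ∀ t, γ t ∈ U)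
    {T : ℝ} (hT : 0 < T) (hγ0 : γ 0 = (0, 0)) (hγT : γ T = (0, 0)) {n : ℕ} (hn : 1 ≤ n)
    (hord : analyticOrderAt (fun t => (γ t).2) 0 = (2 * n : ℕ))
    (hγpos : ∀ t ∈ Ioo 0 T, 0 < (γ t).2) (hγnonneg : ∀ t, 0 ≤ (γ t).2)
    (hP0 : 0 < P (0, 0)) (hQ0 : Q (0, 0) = 0) :
    ∃ (α c : ℕ → ℝ) (r : ℝ), 0 < r ∧ α 0 = 0 ∧ c 0 = T ∧
      (∃ τ φ : ℝ → ℝ, IsHalfReturn P Q U r τ φ) ∧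
      ∀ (x₀ : ℝ) (τ φ : ℝ → ℝ), IsHalfReturn P Q U x₀ τ φ →
        (∀ x ∈ Ico 0 (min r x₀), HasSum (fun i => α i * x ^ i) (φ x)) ∧
        (∀ x ∈ Ioo 0 (min r x₀), HasSum (fun i => c i * x ^ i) (τ x)) := by
  have hf0 : (fun p => (P p, Q p)) ((0 : ℝ), (0 : ℝ)) = (P (0, 0), 0) := by simp [hQ0]
  obtain ⟨ε, hε, δ, hδ, Θ, hΘ⟩ :=
    exists_isTransversalFlow hU hf hγ hγU hT hγ0 hγT hP0.ne' hf0
  obtain ⟨A, B, hA, hB, hA0, hB0, harc⟩ :=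
    hΘ.exists_upperArc hf hT hε hδ hf0 hP0 hγT hn hord hγpos hγnonneg
  obtain ⟨α, hα0, r₁, hr₁, hα⟩ := exists_hasSum_of_analyticAt hA
  obtain ⟨c, hc0, r₂, hr₂, hc⟩ := exists_hasSum_of_analyticAt hB
  -- Analyticity at all nearby points, not only at `0`, supplies the continuity demanded of a
  -- half-return map.
  obtain ⟨r₃, hr₃, h₃⟩ := exists_interval
    (harc.and (hA.eventually_analyticAt.and hB.eventually_analyticAt))
  obtain ⟨r, hr, l1, l2, l3⟩ : ∃ r > 0, r ≤ r₁ ∧ r ≤ r₂ ∧ r ≤ r₃ :=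
    ⟨min r₁ (min r₂ r₃), by positivity, min_le_left _ _,
      (min_le_right _ _).trans (min_le_left _ _), (min_le_right _ _).trans (min_le_right _ _)⟩
  have hmem : ∀ x ∈ Ico 0 r, x ∈ Ioo (-r₁) r₁ ∧ x ∈ Ioo (-r₂) r₂ ∧ x ∈ Ioo (-r₃) r₃ := by
    intro x hx
    refine ⟨⟨?_, ?_⟩, ⟨?_, ?_⟩, ⟨?_, ?_⟩⟩ <;> linarith [hx.1, hx.2]
  refine ⟨α, c, r, hr, by rw [hα0, hA0], by rw [hc0, hB0], ⟨B, A, ?_⟩, ?_⟩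
  · refine ⟨hr, fun x hx => ?_, fun x hx => ?_, hA0, fun x hx => ?_, fun x hx => ?_⟩
    · exact (h₃ x (hmem x (Ioo_subset_Ico_self hx)).2.2).2.2.continuousAt.continuousWithinAt
    · exact (h₃ x (hmem x hx).2.2).2.1.continuousAt.continuousWithinAt
    · exact ((h₃ x (hmem x (Ioo_subset_Ico_self hx)).2.2).1 hx.1).1
    · obtain ⟨-, ψ, t₀, t₁, hψ⟩ := (h₃ x (hmem x (Ioo_subset_Ico_self hx)).2.2).1 hx.1
      have hsub : uIcc 0 (B x) ⊆ Ioo t₀ t₁ := by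
        rw [uIcc_of_le hψ.time_pos.le]
        exact fun t ht => ⟨by linarith [ht.1, hψ.neg], by linarith [ht.2, hψ.lt]⟩
      refine ⟨ψ, ⟨hψ.mapsTo.mono_left hsub, hψ.isIntegralCurveOn.mono hsub⟩, hψ.start, hψ.finish,
        ?_⟩
      rw [uIoo_of_le hψ.time_pos.le]
      exact hψ.above
  · intro x₀ τ φ hτφ
    have key : ∀ x ∈ Ioo 0 (min r x₀), x ∈ Ico 0 r ∧ φ x = A x ∧ τ x = B x := by
      intro x hx
      have hxr : x ∈ Ico 0 r := ⟨hx.1.le, hx.2.trans_le (min_le_left _ _)⟩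
      obtain ⟨-, ψ, t₀, t₁, hψ⟩ := (h₃ x (hmem x hxr).2.2).1 hx.1
      exact ⟨hxr, hτφ.eq_of_isUpperArc hf ⟨hx.1, hx.2.trans_le (min_le_right _ _)⟩ hψ⟩
    refine ⟨fun x hx => ?_, fun x hx => ?_⟩
    -- No arc starts at `x = 0`; there the value is imposed by `map_zero`.
    · rcases hx.1.eq_or_lt with h0 | h0
      · rw [← h0, hτφ.map_zero, ← hA0]
        simpa only [hA0] using hα 0 ⟨by linarith, hr₁⟩
      · obtain ⟨h1, h2, -⟩ := key x ⟨h0, hx.2⟩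
        rw [h2]
        exact hα x (hmem x h1).1
    · obtain ⟨h1, -, h2⟩ := key x hx
      rw [h2]
      exact hc x (hmem x h1).2.1

end HalfReturnMaps

/-! ### The orbit based at the origin and the conclusion -/

/-- A periodic orbit above the horizontal axis, touching it only at the origin, parametrized from
the origin. -/
theorem IsPeriodicOrbit.exists_parametrization {P Q : ℝ × ℝ → ℝ} {U Γ : Set (ℝ × ℝ)} {T : ℝ}
    (hΓ : IsPeriodicOrbit P Q U Γ T) (hΓ_upper : Γ ⊆ upperHalf)
    (hΓ_inter : Γ ∩ switchingLine = {(0, 0)}) :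
    ∃ γ : ℝ → ℝ × ℝ, IsIntegralCurve γ (fun _ p => (P p, Q p)) ∧ (∀ t, γ t ∈ U) ∧
      γ 0 = (0, 0) ∧ Function.Periodic γ T ∧ (∀ t ∈ Ioo 0 T, 0 < (γ t).2) ∧
      ∀ t, 0 ≤ (γ t).2 := by
  obtain ⟨hT, ψ, ⟨hψU, hψ⟩, hper, hinj, hrange⟩ := hΓ
  rw [isIntegralCurveOn_univ] at hψ
  have h0 : ((0 : ℝ), (0 : ℝ)) ∈ range ψ := by
    rw [hrange]
    exact (hΓ_inter.symm ▸ mem_singleton ((0 : ℝ), (0 : ℝ)) :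
      ((0 : ℝ), (0 : ℝ)) ∈ Γ ∩ switchingLine).1
  obtain ⟨s, hs⟩ := h0
  have hnonneg : ∀ t, 0 ≤ (ψ t).2 := fun t => hΓ_upper (hrange ▸ mem_range_self t)
  refine ⟨fun t => ψ (t + s), fun t => (hψ (t + s)).comp_add_const t s,
    fun t => hψU (mem_univ _), by simpa using hs, fun t => ?_, fun t ht => ?_,
    fun t => hnonneg _⟩
  · simp only
    rw [add_right_comm, hper]
  -- A zero at `t` is another passage through the origin; injectivity on one period makes `t` an
  -- integer multiple of `T`, impossible in `(0, T)`.
  · refine lt_of_le_of_ne (hnonneg _) fun hzero => ?_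
    have h1 : ψ (t + s) ∈ Γ ∩ switchingLine := ⟨hrange ▸ mem_range_self _, hzero.symm⟩
    rw [hΓ_inter, mem_singleton_iff, ← hs] at h1
    have hmod : ∀ u, ψ (toIcoMod hT 0 u) = ψ u := fun u => by
      rw [toIcoMod, hper.sub_zsmul_eq]
    rw [← hmod (t + s), ← hmod s] at h1
    have hico : ∀ u, toIcoMod hT 0 u ∈ Ico 0 T := fun u => by
      simpa using toIcoMod_mem_Ico hT 0 u
    have h2 := hinj (hico _) (hico _) h1
    rw [toIcoMod_eq_toIcoMod] at h2
    obtain ⟨k, hk⟩ := h2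
    rw [zsmul_eq_mul] at hk
    have h3 : t = ((-k : ℤ) : ℝ) * T := by push_cast; linarith
    have h4 : (0 : ℝ) < ((-k : ℤ) : ℝ) := by
      by_contra hcon
      rw [not_lt] at hcon
      have := mul_nonpos_of_nonpos_of_nonneg hcon hT.le
      linarith [ht.1]
    have h5 : ((-k : ℤ) : ℝ) < 1 := by
      by_contra hcon
      rw [not_lt] at hcon
      have := mul_le_mul_of_nonneg_right hcon hT.le
      linarith [ht.2]
    have h4' : 0 < -k := by exact_mod_cast h4
    have h5' : -k < 1 := by exact_mod_cast h5
    omega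

/-- The contact order is stated for some local solution; uniqueness transfers it to the global
parametrization. -/
theorem HasContact.analyticOrderAt_eq {P Q : ℝ × ℝ → ℝ} {U : Set (ℝ × ℝ)} {p : ℝ × ℝ} {m : ℕ}
    (h : HasContact P Q U p m) (hf : AnalyticOnNhd ℝ (fun p => (P p, Q p)) U) {γ : ℝ → ℝ × ℝ}
    (hγ : IsIntegralCurve γ (fun _ p => (P p, Q p))) (hγU : ∀ t, γ t ∈ U) (hγ0 : γ 0 = p) :
    analyticOrderAt (fun t => (γ t).2) 0 = m := by
  obtain ⟨ψ, ε, hε, ⟨hψU, hψ⟩, hψ0, hord⟩ := h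
  rw [← hord]
  refine analyticOrderAt_congr ?_
  have heq := eqOn_of_isIntegralCurveOn hf ordConnected_Ioo (hγ.isIntegralCurveOn _) hψ
    (fun t _ => hγU t) hψU (t₀ := 0) ⟨by linarith, hε⟩ (by rw [hγ0, hψ0])
  filter_upwards [Ioo_mem_nhds (show -ε < 0 by linarith) hε] with t ht
  rw [heq ht]

end HalfReturn

theorem mainTheorem11 (P Q : ℝ × ℝ → ℝ) (U Γ : Set (ℝ × ℝ)) (T : ℝ) (n : ℕ)
    (hU : IsOpen U) (hP : AnalyticOnNhd ℝ P U) (hQ : AnalyticOnNhd ℝ Q U)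
    (hΓ : HalfReturn.IsPeriodicOrbit P Q U Γ T)
    (hΓ_upper : Γ ⊆ HalfReturn.upperHalf)
    (hΓ_inter : Γ ∩ HalfReturn.switchingLine = {(0, 0)})
    (hn : 1 ≤ n) (hcontact : HalfReturn.HasContact P Q U (0, 0) (2 * n)) :
    ∃ (α c : ℕ → ℝ) (r : ℝ), 0 < r ∧ α 0 = 0 ∧ |c 0| = T ∧ 0 < P (0, 0) * c 0 ∧
      (∃ τ φ : ℝ → ℝ, HalfReturn.IsHalfReturn P Q U r τ φ) ∧
      ∀ (x₀ : ℝ) (τ φ : ℝ → ℝ), HalfReturn.IsHalfReturn P Q U x₀ τ φ →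
        (∀ x ∈ Set.Ico 0 (min r x₀), HasSum (fun i => α i * x ^ i) (φ x)) ∧
        (∀ x ∈ Set.Ioo 0 (min r x₀), HasSum (fun i => c i * x ^ i) (τ x)) := by
  have hT : 0 < T := hΓ.1
  obtain ⟨γ, hγ, hγU, hγ0, hγper, hγpos, hγnonneg⟩ :=
    hΓ.exists_parametrization hΓ_upper hΓ_inter
  have hf : AnalyticOnNhd ℝ (fun p => (P p, Q p)) U := fun p hp => (hP p hp).prod (hQ p hp)
  have hγT : γ T = (0, 0) := by
    have := hγper 0
    rwa [zero_add, hγ0] at this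
  have hord := hcontact.analyticOrderAt_eq hf hγ hγU hγ0
  have hQ0 : Q (0, 0) = 0 := by
    have h1 := (hγ 0).snd
    rw [hγ0] at h1
    refine IsLocalMin.hasDerivAt_eq_zero (Filter.Eventually.of_forall fun t => ?_) h1
    simpa [hγ0] using hγnonneg t
  -- Otherwise the origin is an equilibrium and `γ` is constant, contradicting `y > 0` at time `T /
  -- 2`.
  have hP0 : P (0, 0) ≠ 0 := by
    intro h0
    have hconst : IsIntegralCurve (fun _ : ℝ => ((0 : ℝ), (0 : ℝ))) (fun _ p => (P p, Q p)) := by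
      intro t
      have h1 : (P (0, 0), Q (0, 0)) = 0 := by rw [h0, hQ0]; rfl
      simp only [h1]
      exact hasDerivAt_const t _
    have h2 := HalfReturn.eqOn_of_isIntegralCurveOn hf Set.ordConnected_univ
      (hγ.isIntegralCurveOn _) (hconst.isIntegralCurveOn _) (fun t _ => hγU t)
      (fun _ _ => hγ0 ▸ hγU 0) (Set.mem_univ 0) hγ0 (Set.mem_univ (T / 2))
    have h3 := hγpos (T / 2) ⟨by linarith, by linarith⟩
    rw [h2] at h3
    exact lt_irrefl _ h3
  -- For `P(0,0) < 0` time is reversed: the series of `φ` is kept and that of `τ` changes sign, so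
  -- `c 0 = -T`.
  rcases hP0.lt_or_gt with hneg | hpos
  · have hγr : IsIntegralCurve (fun t => γ (-t)) (fun _ p => (-P p, -Q p)) := by
      intro t
      have := (hγ (-t)).scomp t (hasDerivAt_neg t)
      simpa using! this
    have hrev : ∀ t, γ (-t) = γ (T - t) := fun t => by
      rw [← hγper (-t), neg_add_eq_sub]
    have hordr : analyticOrderAt (fun t => (γ (-t)).2) 0 = (2 * n : ℕ) := by
      have h := analyticOrderAt_comp_of_deriv_ne_zero (f := fun t => (γ t).2)
        (g := fun t : ℝ => -t) (z₀ := 0) analyticAt_id.neg (by simp)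
      rw [neg_zero, hord] at h
      exact h
    obtain ⟨α, c, r, hr, hα0, hc0, ⟨τ, φ, hτφ⟩, hall⟩ :=
      HalfReturn.exists_series_of_pos (P := fun p => -P p) (Q := fun p => -Q p) hU
        (fun p hp => (hP p hp).neg.prod (hQ p hp).neg) hγr (fun t => hγU _) hT
        (by simpa using hγ0) (by simpa [hrev] using hγ0) hn hordr
        (fun t ht => by
          rw [hrev]
          exact hγpos _ ⟨by linarith [ht.2], by linarith [ht.1]⟩)
        (fun t => hγnonneg _) (by simpa using hneg) (by simpa using hQ0)
    refine ⟨α, fun i => -c i, r, hr, hα0, by simp [hc0, abs_of_pos hT], ?_,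
      ⟨fun x => -τ x, φ, by simpa using hτφ.reverse⟩, fun x₀ τ φ h => ?_⟩
    · simp only [hc0]
      exact mul_pos_of_neg_of_neg hneg (by linarith)
    · obtain ⟨h1, h2⟩ := hall x₀ _ φ h.reverse
      refine ⟨h1, fun x hx => ?_⟩
      simpa using (h2 x hx).neg
  · obtain ⟨α, c, r, hr, hα0, hc0, hex, hall⟩ :=
      HalfReturn.exists_series_of_pos hU hf hγ hγU hT hγ0 hγT hn hord hγpos hγnonneg hpos hQ0
    exact ⟨α, c, r, hr, hα0, by rw [hc0, abs_of_pos hT], by rw [hc0]; exact mul_pos hpos hT,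
      hex, hall⟩
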